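/- Let $n=2j\in\mathbb N$ (including $n=0$), and let $\mathcal B(\mathcal H_j)=M_{\mathbb C}(n+1)$ be the operators on the spin-$j$ space $\mathcal H_j=\mathbb C^{n+1}$ with standard basis $\mathbf u(j,j),\mathbf u(j,j-1),\dots,\mathbf u(j,-j)$, with Hilbert–Schmidt inner product $\langle P,Q\rangle=\mathrm{trace}(P^*Q)$. *Coupled basis.* Let $J_+$ be the raising matrix, whose only nonzero entries are $(J_+)_{k,k+1}=\sqrt{(n-k+1)k}$ $(1\le k\le n)$, let $J_-=J_+^T$, and let $\beta_{l,m}=\sqrt{(l+m)(l-m+1)}$. For $0\le l\le n$ put $\mathbf e^j(l,l)=(-1)^lJ_+^l/\|J_+^l\|$ and $\mathbf e^j(l,m-1)=\beta_{l,m}^{-1}[J_-,\mathbf e^j(l,m)]$ for $-l<m\le l$. *Wigner product symbol.* For $-j\le \mu_1,\mu_2\le j$ let $|j\mu_1j\mu_2\rangle=(-1)^{j+\mu_2}\mathcal E$, where $\mathcal E$ is the one-element matrix with entry $1$ in the row of $\mathbf u(j,\mu_1)$ and the column of $\mathbf u(j,-\mu_2)$. The Clebsch–Gordan coefficients are $C^{j,j,l}_{\mu_1,\mu_2,m}=\langle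 \mathbf e^j(l,m),|j\mu_1j\mu_2\rangle\rangle$ (and $0$ if $|m|>l$). The Wigner product symbol is defined by $$(-1)^{2j-m_3}\begin{bmatrix} l_1&l_2&l_3\\ m_1&m_2&m_3\end{bmatrix}[j]=\sum_{\mu_1,\mu_2,\mu_3=-j}^{j}(-1)^{j+\mu_2}\,C^{j,j,l_1}_{\mu_1,\mu_2,m_1}\,C^{j,j,l_2}_{-\mu_2,\mu_3,m_2}\,C^{j,j,l_3}_{\mu_1,\mu_3,-m_3}.$$ *Spherical harmonics.* On $S^2=\{x^2+y^2+z^2=1\}$ let $Y_l^l=\frac{(-1)^l}{\lambda_l}(x+iy)^l$ with $\lambda_l=\frac{l!\,2^l}{\sqrt{(2l+1)!}}$, and $Y_l^{m-1}=\beta_{l,m}^{-1}J_-Y_l^m$ for $-l<m\le l$, where $J_-=J_1-iJ_2$, $J_1=-i(y\partial_z-z\partial_y)$, $J_2=-i(z\partial_x-x\partial_z)$; put $Y_l^m=0$ for $|m|>l$. (These are the spherical harmonics, orthonormal for $\frac1{4\pi}\int_{S^2}\overline F\,G\,dS$.) Let $Poly_{\mathbb C}(S^2)_{\le n}$ be the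 space of restrictions to $S^2$ of complex polynomials of degree $\le n$. **Theorem.** Let $c_0=1$ and let $c_1,\dots,c_n$ be nonzero real numbers. There is exactly one linear map $W=W_{\vec c}^{j}$ from $\mathcal B(\mathcal H_j)$ to functions on $S^2$ with $$W\big(\sqrt{n+1}\;\mathbf e^j(l,m)\big)=c_l\,Y_l^m ,\qquad -l\le m\le l\le n$$ (the symbol correspondence with characteristic numbers $c_l$). It is injective with range $Poly_{\mathbb C}(S^2)_{\le n}$, so the operator product induces a twisted product $\star=\star^n_{\vec c}$ on $Poly_{\mathbb C}(S^2)_{\le n}$ by $W(P)\star W(Q)=W(PQ)$, and for all $l_1,l_2\le n$, $|m_1|\le l_1$, $|m_2|\le l_2$, with $m=m_1+m_2$, $$Y_{l_1}^{m_1}\star^n_{\vec c}Y_{l_2}^{m_2}=(-1)^{n+m}\sqrt{n+1}\sum_{l=0}^{n}\begin{bmatrix} l_1&l_2&l\\ m_1&m_2&-m\end{bmatrix}[j]\;\frac{c_l}{c_{l_1}c_{l_2}}\;Y_l^m .\tag{1}$$ **Corollary.** (a) The standard twisted product, i.e. the one of the standard Stratonovich–Weyl correspondence (all $c_l=1$),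 is given by $$Y_{l_1}^{m_1}\star^n_{1}Y_{l_2}^{m_2}=(-1)^{n+m}\sqrt{n+1}\sum_{l=0}^{n}\begin{bmatrix} l_1&l_2&l\\ m_1&m_2&-m\end{bmatrix}[j]\;Y_l^m .$$ (b) The standard Berezin correspondence, given by $W_P(\mathbf n)=\langle \Phi(\mathbf z),P\,\Phi(\mathbf z)\rangle$, where $\mathbf z=(z_1,z_2)\in\mathbb C^2$ is any unit vector over $\mathbf n=(x,y,z)$ under the Hopf map $x+iy=2\bar z_1z_2$, $z=|z_1|^2-|z_2|^2$, and $\Phi(\mathbf z)=\big(\sqrt{\tbinom nk}\,z_1^{n-k}z_2^k\big)_{0\le k\le n}$, is the correspondence with characteristic numbers $b_l^n=\sqrt{\binom nl}\big/\sqrt{\binom{n+l+1}{l}}$. Its twisted product is given by (1) with the factor $c_l/(c_{l_1}c_{l_2})$ replaced by $b^n_l/(b^n_{l_1}b^n_{l_2})$, where, for all $l_1,l_2,l_3\le n$, $$\frac{b^n_{l_3}}{b^n_{l_1}b^n_{l_2}}=\sqrt{\frac{\binom{n+l_1+1}{l_1}\binom{n+l_2+1}{l_2}\binom{n}{l_3}}{\binom{n}{l_1}\binom{n}{l_2}\binom{n+l_3+1}{l_3}}}=\sqrt{\frac{(n+l_1+1)!\,(n+l_2+1)!\,(n-l_1)!\,(n-l_2)!}{(n+l_3+1)!\,(n-l_3)!\,(n+1)!\,n!}}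 .$$ -/

import Mathlib

/-! Spin-`j` systems and spherical symbols, `n = 2j`.

The Hilbert space of the spin-`j` system is `ℂ^(n+1)`; the operators are the complex matrices
indexed by `Fin (n+1)`, the index `k` (starting at `0`) standing for the standard basis vector
`u(j, j - k)` of magnetic number `j - k`. -/

namespace SpinSymbols

open scoped Matrix

/-! ### Operators: the coupled standard basis -/

/-- The raising operator `J₊` in the standard basis: `(J₊)_{k,k+1} = √((n-k)(k+1))`. -/
noncomputable def Jplus (n : ℕ) : Matrix (Fin (n + 1)) (Fin (n + 1)) ℝ :=
  Matrix.of fun a b =>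
    if (b : ℕ) = (a : ℕ) + 1 then Real.sqrt (((n : ℝ) - (a : ℕ)) * ((a : ℕ) + 1)) else 0

/-- The lowering operator `J₋ = J₊ᵀ`. -/
noncomputable def Jminus (n : ℕ) : Matrix (Fin (n + 1)) (Fin (n + 1)) ℝ := (Jplus n)ᵀ

/-- The Hilbert-Schmidt norm of `J₊^l`. -/
noncomputable def muNorm (n l : ℕ) : ℝ :=
  Real.sqrt (Matrix.trace (Jminus n ^ l * Jplus n ^ l))

/-- `β_{l,m} = √((l+m)(l-m+1))`, the coefficient of the lowering operator. -/
noncomputable def betaCoeff (l : ℕ) (m : ℤ) : ℝ :=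
  Real.sqrt (((l : ℝ) + m) * ((l : ℝ) - m + 1))

/-- The matrix `e^j(l, l-k)`, by recursion on `k`:
`e(l,l) = (-1)^l J₊^l / ‖J₊^l‖` and `e(l,m-1) = [J₋, e(l,m)] / β_{l,m}`. -/
noncomputable def coupledAux (n l : ℕ) : ℕ → Matrix (Fin (n + 1)) (Fin (n + 1)) ℝ
  | 0 => ((-1) ^ l / muNorm n l) • Jplus n ^ l
  | k + 1 => (betaCoeff l ((l : ℤ) - k))⁻¹ •
      (Jminus n * coupledAux n l k - coupledAux n l k * Jminus n)

/-- The coupled standard basis `e^j(l,m)`, `-l ≤ m ≤ l` (set to `0` for other `m`). -/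
noncomputable def coupled (n l : ℕ) (m : ℤ) : Matrix (Fin (n + 1)) (Fin (n + 1)) ℝ :=
  if |m| ≤ (l : ℤ) then coupledAux n l ((l : ℤ) - m).toNat else 0

/-- `e^j(l,m)` as a complex matrix. -/
noncomputable def coupledC (n l : ℕ) (m : ℤ) : Matrix (Fin (n + 1)) (Fin (n + 1)) ℂ :=
  (coupled n l m).map Complex.ofReal

/-! ### Clebsch-Gordan coefficients and the Wigner product symbol -/

/-- The uncoupled standard basis vector `|j m₁ j m₂⟩ = u(j,m₁) ⊗ ǔ(j,m₂)` as a matrix, where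
`m₁ = j - a`, `m₂ = j - b`: it is `(-1)^(j+m₂)` times the one-element matrix in row `u(j,m₁)` and
column `u(j,-m₂)`. -/
def uncoupled (n : ℕ) (a b : Fin (n + 1)) : Matrix (Fin (n + 1)) (Fin (n + 1)) ℝ :=
  Matrix.single a (Fin.rev b) ((-1) ^ (n - (b : ℕ)))

/-- The Clebsch-Gordan coefficient `C^{j,j,l}_{m₁,m₂,m} = ⟨(jj)lm | j m₁ j m₂⟩`
(Hilbert-Schmidt inner product of real matrices), where `m₁ = j - a`, `m₂ = j - b`. -/
noncomputable def clebschGordan (n : ℕ) (a b : Fin (n + 1)) (l : ℕ) (m : ℤ) : ℝ :=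
  Matrix.trace ((coupled n l m)ᵀ * uncoupled n a b)

/-- The product coefficients `M[j]^{l₁,l₂,l}_{m₁,m₂,m}`: the sum over `μ₁, μ₂, μ₃` of
`(-1)^(j+μ₂) C^{j,j,l₁}_{μ₁,μ₂,m₁} C^{j,j,l₂}_{-μ₂,μ₃,m₂} C^{j,j,l}_{μ₁,μ₃,m}`,
with `μᵢ = j - aᵢ`. -/
noncomputable def productCoeff (n l₁ l₂ l : ℕ) (m₁ m₂ m : ℤ) : ℝ :=
  ∑ a₁ : Fin (n + 1), ∑ a₂ : Fin (n + 1), ∑ a₃ : Fin (n + 1),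
    (-1) ^ (n - (a₂ : ℕ)) * clebschGordan n a₁ a₂ l₁ m₁ *
      clebschGordan n (Fin.rev a₂) a₃ l₂ m₂ * clebschGordan n a₁ a₃ l m

/-- The Wigner product symbol `[l₁ l₂ l₃; m₁ m₂ m₃][j]`, determined by
`M[j]^{l₁,l₂,l₃}_{m₁,m₂,-m₃} = (-1)^(2j-m₃) [l₁ l₂ l₃; m₁ m₂ m₃][j]`. -/
noncomputable def wignerProduct (n l₁ l₂ l₃ : ℕ) (m₁ m₂ m₃ : ℤ) : ℝ :=
  (-1) ^ ((n : ℤ) - m₃) * productCoeff n l₁ l₂ l₃ m₁ m₂ (-m₃)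

/-! ### Functions on the unit sphere: spherical harmonics -/

/-- The unit sphere `S²` in `ℝ³`. -/
abbrev Sphere2 : Type := Metric.sphere (0 : EuclideanSpace ℝ (Fin 3)) 1

/-- Restriction of complex polynomials in `x, y, z` to the sphere. -/
noncomputable def restrict : MvPolynomial (Fin 3) ℂ →ₗ[ℂ] (Sphere2 → ℂ) where
  toFun p := fun x => MvPolynomial.eval (fun i => ((x.1 i : ℝ) : ℂ)) p
  map_add' p q := by
    funext x
    simp
  map_smul' r p := by
    funext x
    simp [MvPolynomial.smul_eval]

/-- `Poly_ℂ(S²)_{≤ n}`: restrictions to the sphere of polynomials of degree at most `n`. -/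
noncomputable def polySphere (n : ℕ) : Submodule ℂ (Sphere2 → ℂ) :=
  (MvPolynomial.restrictTotalDegree (Fin 3) ℂ n).map restrict

/-- The lowering operator `J₋ = J₁ - i J₂` on polynomial functions, where
`J₁ = -i (y ∂_z - z ∂_y)` and `J₂ = -i (z ∂_x - x ∂_z)`. -/
noncomputable def JminusPoly (p : MvPolynomial (Fin 3) ℂ) : MvPolynomial (Fin 3) ℂ :=
  let J₁ := MvPolynomial.C (-Complex.I) *
    (MvPolynomial.X 1 * MvPolynomial.pderiv 2 p - MvPolynomial.X 2 * MvPolynomial.pderiv 1 p)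
  let J₂ := MvPolynomial.C (-Complex.I) *
    (MvPolynomial.X 2 * MvPolynomial.pderiv 0 p - MvPolynomial.X 0 * MvPolynomial.pderiv 2 p)
  J₁ - MvPolynomial.C Complex.I * J₂

/-- `λ_l = l! 2^l / √((2l+1)!)`, the norm of `(x+iy)^l` in `L²(S², dS/4π)`. -/
noncomputable def lambdaNorm (l : ℕ) : ℝ :=
  (l.factorial : ℝ) * 2 ^ l / Real.sqrt ((2 * l + 1).factorial : ℝ)

/-- A polynomial for `Y_{l,l-k}`, by recursion on `k`:
`Y_{l,l} = (-1)^l (x+iy)^l / λ_l` and `Y_{l,m-1} = J₋ Y_{l,m} / β_{l,m}`. -/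
noncomputable def harmonicAux (l : ℕ) : ℕ → MvPolynomial (Fin 3) ℂ
  | 0 => MvPolynomial.C (((-1) ^ l / lambdaNorm l : ℝ) : ℂ) *
      (MvPolynomial.X 0 + MvPolynomial.C Complex.I * MvPolynomial.X 1) ^ l
  | k + 1 => MvPolynomial.C (((betaCoeff l ((l : ℤ) - k))⁻¹ : ℝ) : ℂ) *
      JminusPoly (harmonicAux l k)

/-- The spherical harmonic `Y_l^m`, `-l ≤ m ≤ l` (set to `0` for other `m`), orthonormal in
`L²(S², dS/4π)`. -/
noncomputable def sphHarm (l : ℕ) (m : ℤ) : Sphere2 → ℂ :=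
  if |m| ≤ (l : ℤ) then restrict (harmonicAux l ((l : ℤ) - m).toNat) else 0

/-! ### Symbol maps and twisted products -/

/-- The linear map `W` is the symbol map with characteristic numbers `c_l`: with `μ₀ = √(n+1)`,
`W (μ₀ e^j(l,m)) = c_l Y_l^m` for `-l ≤ m ≤ l ≤ n`. -/
def HasCharNumbers (n : ℕ) (c : ℕ → ℝ)
    (W : Matrix (Fin (n + 1)) (Fin (n + 1)) ℂ →ₗ[ℂ] (Sphere2 → ℂ)) : Prop :=
  ∀ l : ℕ, l ≤ n → ∀ m : ℤ, |m| ≤ (l : ℤ) →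
    W (((Real.sqrt ((n : ℝ) + 1) : ℝ) : ℂ) • coupledC n l m) = ((c l : ℝ) : ℂ) • sphHarm l m

/-- The twisted product of symbols induced by the operator product via `W`: for symbols `f`, `g`
of operators `P`, `Q` it is the symbol of `P Q`. (Meaningful for injective `W` and for `f`, `g` in
the range of `W`.) -/
noncomputable def twistedProduct {n : ℕ}
    (W : Matrix (Fin (n + 1)) (Fin (n + 1)) ℂ →ₗ[ℂ] (Sphere2 → ℂ)) (f g : Sphere2 → ℂ) :
    Sphere2 → ℂ :=
  W (Function.invFun W f * Function.invFun W g)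

/-- The coherent state vector `Φ_j(z₁,z₂)`, with components `√(binom n k) z₁^(n-k) z₂^k`. -/
noncomputable def coherent (n : ℕ) (z₁ z₂ : ℂ) : Fin (n + 1) → ℂ := fun k =>
  ((Real.sqrt (n.choose (k : ℕ) : ℝ) : ℝ) : ℂ) * z₁ ^ (n - (k : ℕ)) * z₂ ^ (k : ℕ)

/-- The point `x` of the sphere is the image of `(z₁,z₂)` under the Hopf map:
`x + iy = 2 z̄₁ z₂`, `z = |z₁|² - |z₂|²`. -/
def IsHopf (z₁ z₂ : ℂ) (x : Sphere2) : Prop :=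
  ((x.1 0 : ℝ) : ℂ) + Complex.I * ((x.1 1 : ℝ) : ℂ) = 2 * (starRingEnd ℂ) z₁ * z₂ ∧
    x.1 2 = ‖z₁‖ ^ 2 - ‖z₂‖ ^ 2

/-- `W` is the standard Berezin symbol map: `W_P(𝐧) = ⟨Φ_j(z), P Φ_j(z)⟩` for every unit vector
`z = (z₁,z₂)` of `ℂ²` above the point `𝐧` of the sphere. -/
def IsStandardBerezin (n : ℕ)
    (W : Matrix (Fin (n + 1)) (Fin (n + 1)) ℂ →ₗ[ℂ] (Sphere2 → ℂ)) : Prop :=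
  ∀ (P : Matrix (Fin (n + 1)) (Fin (n + 1)) ℂ) (x : Sphere2) (z₁ z₂ : ℂ),
    ‖z₁‖ ^ 2 + ‖z₂‖ ^ 2 = 1 → IsHopf z₁ z₂ x →
      W P x = star (coherent n z₁ z₂) ⬝ᵥ (P *ᵥ coherent n z₁ z₂)

/-- The characteristic numbers `b_l^n = √(binom n l) / √(binom (n+l+1) l)` of the standard Berezin
correspondence. -/
noncomputable def berezinNumber (n l : ℕ) : ℝ :=
  Real.sqrt (n.choose l : ℝ) / Real.sqrt ((n + l + 1).choose l : ℝ)

end SpinSymbols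

/-! Under `ad J₊` and `ad J₋` the matrices e(l,m) form sl₂ ladders with highest weight vectors
proportional to J₊^l. Since `ad J₊` and `ad J₋` are adjoint for the trace form, the ladders are
orthonormal, and there are 1 + 3 + ... + (2n+1) = (n+1)² vectors, so they form a basis
(`trace_coupledAux`, `coupledBasis`). The product e(l₁,m₁) e(l₂,m₂) therefore expands with
coefficients trace(e(l,m)ᵀ e(l₁,m₁) e(l₂,m₂)). These vanish unless m = m₁ + m₂, because e(l,m) lives
on a single off-diagonal, and once the signs in the Clebsch–Gordan coefficients cancel they are the
sums defining the Wigner product symbol (`productCoeff_eq_trace`). Applying W to this expansion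
gives the formula for the twisted product, provided W is injective.

Injectivity and range are proved for the Berezin numbers first. The Berezin symbol of a matrix is a
polynomial of bidegree (n,n) in z̄ and z. Commutation with J₋ acts on such polynomials as a
derivation which annihilates N = |z₁|² + |z₂|² and which is also the pullback of the rotation
operator J₋ along the Hopf map (`hopfHom_JminusPoly`). Matrices and harmonics thus descend their
ladders in parallel, and comparing highest weight vectors alone yields that √(n+1) e(l,m) has symbol
b_l · (Y_l^m ∘ Hopf) · N^(n-l) (`symbPoly_coupledAux`). As N = 1 on unit vectors, the Berezin map
has characteristic numbers b_l.

A matrix with zero Berezin symbol is zero, because a polynomial in t̄ and t vanishing for all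
complex t has zero coefficients. Conversely, a monomial of degree d ≤ n in x, y, z, pulled back and
multiplied by N^(n-d), has bidegree (n,n), hence is the symbol of a matrix. Any other correspondence
is the Berezin one preceded by an invertible rescaling of the coupled basis
(`HasCharNumbers.eq_comp_scaleCoupled`), so it inherits both properties. -/

namespace SpinSymbols

open scoped Matrix

/-! ### Operators supported on one off-diagonal -/

/-- The matrix `A` is supported on the off-diagonal of column index minus row index `m`. -/
def IsBand {n : ℕ} (m : ℤ) (A : Matrix (Fin (n + 1)) (Fin (n + 1)) ℝ) : Prop :=
  ∀ a b : Fin (n + 1), ((b : ℕ) : ℤ) - ((a : ℕ) : ℤ) ≠ m → A a b = 0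

theorem IsBand.mul {n : ℕ} {m m' : ℤ} {A B : Matrix (Fin (n + 1)) (Fin (n + 1)) ℝ}
    (hA : IsBand m A) (hB : IsBand m' B) : IsBand (m + m') (A * B) := by
  intro a b h
  rw [Matrix.mul_apply]
  refine Finset.sum_eq_zero fun c _ => ?_
  by_cases hc : ((c : ℕ) : ℤ) - ((a : ℕ) : ℤ) = m
  · rw [hB c b (by omega), mul_zero]
  · rw [hA a c hc, zero_mul]

theorem IsBand.smul {n : ℕ} {m : ℤ} {A : Matrix (Fin (n + 1)) (Fin (n + 1)) ℝ}
    (hA : IsBand m A) (r : ℝ) : IsBand m (r • A) := by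
  intro a b h
  rw [Matrix.smul_apply, hA a b h, smul_zero]

theorem IsBand.sub {n : ℕ} {m : ℤ} {A B : Matrix (Fin (n + 1)) (Fin (n + 1)) ℝ}
    (hA : IsBand m A) (hB : IsBand m B) : IsBand m (A - B) := by
  intro a b h
  rw [Matrix.sub_apply, hA a b h, hB a b h, sub_zero]

theorem isBand_Jplus (n : ℕ) : IsBand 1 (Jplus n) := by
  intro a b h
  simp only [Jplus, Matrix.of_apply]
  exact if_neg (by omega)

theorem isBand_Jminus (n : ℕ) : IsBand (-1) (Jminus n) := by
  intro a b h
  exact isBand_Jplus n b a (by omega)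

theorem isBand_Jplus_pow (n l : ℕ) : IsBand l (Jplus n ^ l) := by
  induction l with
  | zero =>
    intro a b h
    rw [pow_zero, Matrix.one_apply, if_neg]
    rintro rfl
    simp at h
  | succ l ih =>
    rw [pow_succ, Nat.cast_succ]
    exact ih.mul (isBand_Jplus n)

theorem isBand_coupledAux (n l k : ℕ) : IsBand ((l : ℤ) - k) (coupledAux n l k) := by
  induction k with
  | zero =>
    simp only [coupledAux, Nat.cast_zero, sub_zero]
    exact (isBand_Jplus_pow n l).smul _
  | succ k ih =>
    have h1 := (isBand_Jminus n).mul ih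
    have h2 := ih.mul (isBand_Jminus n)
    rw [show (-1 : ℤ) + (l - k) = l - (k + 1 : ℕ) by push_cast; ring] at h1
    rw [show ((l : ℤ) - k) + -1 = l - (k + 1 : ℕ) by push_cast; ring] at h2
    exact (h1.sub h2).smul _

/-! ### The trace pairing. -/

theorem trace_transpose_mul {ι R : Type*} [Fintype ι] [CommSemiring R] (A B : Matrix ι ι R) :
    Matrix.trace (Aᵀ * B) = ∑ a, ∑ b, A a b * B a b := by
  simp only [Matrix.trace, Matrix.diag, Matrix.mul_apply, Matrix.transpose_apply]
  exact Finset.sum_comm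

theorem IsBand.trace_eq_zero {n : ℕ} {m m' : ℤ} {A B : Matrix (Fin (n + 1)) (Fin (n + 1)) ℝ}
    (hA : IsBand m A) (hB : IsBand m' B) (h : m ≠ m') : Matrix.trace (Aᵀ * B) = 0 := by
  rw [trace_transpose_mul]
  refine Finset.sum_eq_zero fun a _ => Finset.sum_eq_zero fun b _ => ?_
  by_cases hc : ((b : ℕ) : ℤ) - ((a : ℕ) : ℤ) = m
  · rw [hB a b (by omega), mul_zero]
  · rw [hA a b hc, zero_mul]

/-! ### The commutation relations -/

theorem Jplus_mul_Jminus (n : ℕ) : Jplus n * Jminus n =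
    Matrix.diagonal fun a : Fin (n + 1) => ((n : ℝ) - (a : ℕ)) * ((a : ℕ) + 1) := by
  ext a b
  by_cases hab : a = b
  · subst hab
    rw [Matrix.diagonal_apply_eq, Matrix.mul_apply]
    have ha : ((a : ℕ) : ℝ) ≤ n := by exact_mod_cast Nat.lt_succ_iff.mp a.2
    have hnn : 0 ≤ ((n : ℝ) - (a : ℕ)) * ((a : ℕ) + 1) :=
      mul_nonneg (sub_nonneg.2 ha) (by positivity)
    by_cases hn : (a : ℕ) = n
    · rw [hn, sub_self, zero_mul]
      refine Finset.sum_eq_zero fun c _ => ?_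
      rw [isBand_Jplus n a c (by omega), zero_mul]
    · rw [Finset.sum_eq_single (⟨a + 1, by omega⟩ : Fin (n + 1))]
      · simp [Jminus, Jplus, Real.mul_self_sqrt hnn]
      · intro c _ hc
        rw [isBand_Jplus n a c, zero_mul]
        intro h
        exact hc (Fin.ext (by simp; omega))
      · simp
  · rw [Matrix.diagonal_apply_ne _ hab]
    exact ((isBand_Jplus n).mul (isBand_Jminus n)) a b (by
      intro h
      exact hab (Fin.ext (by omega)))

theorem Jminus_mul_Jplus (n : ℕ) : Jminus n * Jplus n =
    Matrix.diagonal fun a : Fin (n + 1) => ((n : ℝ) - (a : ℕ) + 1) * ((a : ℕ)) := by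
  ext a b
  by_cases hab : a = b
  · subst hab
    rw [Matrix.diagonal_apply_eq, Matrix.mul_apply]
    have ha : ((a : ℕ) : ℝ) ≤ n := by exact_mod_cast Nat.lt_succ_iff.mp a.2
    by_cases hn : (a : ℕ) = 0
    · rw [hn, Nat.cast_zero, mul_zero]
      refine Finset.sum_eq_zero fun c _ => ?_
      rw [isBand_Jplus n c a (by omega), mul_zero]
    · rw [Finset.sum_eq_single (⟨a - 1, by omega⟩ : Fin (n + 1))]
      · have h1 : (a : ℕ) = (a : ℕ) - 1 + 1 := by omega
        have h2 : (((a : ℕ) - 1 : ℕ) : ℝ) = (a : ℕ) - 1 := by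
          rw [Nat.cast_sub (by omega), Nat.cast_one]
        have h3 : ((n : ℝ) - (((a : ℕ) - 1 : ℕ) : ℝ)) * ((((a : ℕ) - 1 : ℕ) : ℝ) + 1) =
            ((n : ℝ) - (a : ℕ) + 1) * (a : ℕ) := by rw [h2]; ring
        simp only [Jminus, Jplus, Matrix.transpose_apply, Matrix.of_apply, if_pos h1]
        rw [h3, Real.mul_self_sqrt (mul_nonneg (by linarith) (by positivity))]
      · intro c _ hc
        rw [isBand_Jplus n c a, mul_zero]
        intro h
        exact hc (Fin.ext (by simp; omega))
      · simp
  · rw [Matrix.diagonal_apply_ne _ hab]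
    exact ((isBand_Jminus n).mul (isBand_Jplus n)) a b (by
      intro h
      exact hab (Fin.ext (by omega)))

/-- The commutator [J₊, J₋] is diagonal with entries n - 2a, and (n - 2a) - (n - 2b) = 2(b - a).
This is the weight relation of sl₂, with the off-diagonal as weight. -/
theorem IsBand.commutator {n : ℕ} {m : ℤ} {A : Matrix (Fin (n + 1)) (Fin (n + 1)) ℝ}
    (hA : IsBand m A) : ⁅⁅Jplus n, Jminus n⁆, A⁆ = (2 * (m : ℝ)) • A := by
  ext a b
  rw [Ring.lie_def, Ring.lie_def, Jplus_mul_Jminus, Jminus_mul_Jplus, Matrix.diagonal_sub,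
    Matrix.sub_apply, Matrix.diagonal_mul, Matrix.mul_diagonal, Matrix.smul_apply, smul_eq_mul]
  by_cases hc : ((b : ℕ) : ℤ) - ((a : ℕ) : ℤ) = m
  · rw [← hc]
    push_cast
    ring
  · rw [hA a b hc]
    ring

/-- Since J₋ is the transpose of J₊, lowering and raising are adjoint; this moves a lowering step
from one side of the pairing to a raising step on the other. -/
theorem trace_lie_adjoint {n : ℕ} (A B : Matrix (Fin (n + 1)) (Fin (n + 1)) ℝ) :
    Matrix.trace (⁅Jminus n, A⁆ᵀ * B) = Matrix.trace (Aᵀ * ⁅Jplus n, B⁆) := by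
  simp only [Ring.lie_def, Jminus, Matrix.transpose_sub, Matrix.transpose_mul,
    Matrix.transpose_transpose, sub_mul, mul_sub, Matrix.trace_sub]
  rw [Matrix.mul_assoc, Matrix.mul_assoc, Matrix.trace_mul_comm (Jplus n), Matrix.mul_assoc]

theorem lie_smul_right {ι R : Type*} [Fintype ι] [CommRing R] (A B : Matrix ι ι R) (r : R) :
    ⁅A, r • B⁆ = r • ⁅A, B⁆ := by
  simp only [Ring.lie_def, mul_smul_comm, smul_mul_assoc, smul_sub]

/-! ### Ladder relations and orthonormality of the coupled basis -/

theorem betaCoeff_sq {l k : ℕ} (hk : k ≤ 2 * l) :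
    betaCoeff l ((l : ℤ) - k) ^ 2 = (2 * (l : ℝ) - k) * (k + 1) := by
  have hk' : (k : ℝ) ≤ 2 * l := by exact_mod_cast hk
  have h : ((l : ℝ) + ((l : ℤ) - (k : ℤ) : ℤ)) * ((l : ℝ) - ((l : ℤ) - (k : ℤ) : ℤ) + 1) =
      (2 * (l : ℝ) - k) * (k + 1) := by push_cast; ring
  rw [betaCoeff, h, Real.sq_sqrt (mul_nonneg (by linarith) (by positivity))]

theorem betaCoeff_ne_zero {l k : ℕ} (hk : k < 2 * l) : betaCoeff l ((l : ℤ) - k) ≠ 0 := by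
  have hk' : (k : ℝ) < 2 * l := by exact_mod_cast hk
  have h := betaCoeff_sq hk.le
  intro h0
  rw [h0] at h
  have : 0 < (2 * (l : ℝ) - k) * (k + 1) := mul_pos (by linarith) (by positivity)
  linarith

theorem coupledAux_succ (n l k : ℕ) :
    coupledAux n l (k + 1) = (betaCoeff l ((l : ℤ) - k))⁻¹ • ⁅Jminus n, coupledAux n l k⁆ := rfl

theorem lie_Jminus_coupledAux (n : ℕ) {l k : ℕ} (hk : k < 2 * l) :
    ⁅Jminus n, coupledAux n l k⁆ = betaCoeff l ((l : ℤ) - k) • coupledAux n l (k + 1) := by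
  rw [coupledAux_succ, smul_smul, mul_inv_cancel₀ (betaCoeff_ne_zero hk), one_smul]

theorem lie_Jplus_coupledAux_zero (n l : ℕ) : ⁅Jplus n, coupledAux n l 0⁆ = 0 := by
  simp only [coupledAux, Ring.lie_def, mul_smul_comm, smul_mul_assoc, ← pow_succ, ← pow_succ',
    sub_self]

/-- The standard sl₂ computation: by the Jacobi identity, raising after lowering equals lowering
after raising plus the weight 2(l - k), and the top vector is annihilated by raising. -/
theorem lie_Jplus_coupledAux_succ (n : ℕ) {l k : ℕ} (hk : k < 2 * l) :
    ⁅Jplus n, coupledAux n l (k + 1)⁆ = betaCoeff l ((l : ℤ) - k) • coupledAux n l k := by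
  have key : ∀ k, ⁅Jplus n, ⁅Jminus n, coupledAux n l k⁆⁆ =
      (⁅Jminus n, ⁅Jplus n, coupledAux n l k⁆⁆ + (2 * ((l : ℝ) - k)) • coupledAux n l k) := by
    intro k
    have h := (isBand_coupledAux n l k).commutator
    push_cast at h
    rw [← h]
    simp only [Ring.lie_def]
    noncomm_ring
  have hb := betaCoeff_ne_zero hk
  rw [coupledAux_succ, lie_smul_right, key k, inv_smul_eq_iff₀ hb, smul_smul, ← pow_two,
    betaCoeff_sq hk.le]
  -- What remains is that lowering after raising, plus 2(l - k), acts on the k-th vector as (2l -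
  -- k)(k + 1). The inductive step is the identity k(2l - k + 1) + 2(l - k) = (k + 1)(2l - k), with
  -- k shifted by one.
  induction k with
  | zero =>
    rw [lie_Jplus_coupledAux_zero, Ring.lie_def, mul_zero, zero_mul, sub_zero, zero_add]
    congr 1
    push_cast
    ring
  | succ k ih =>
    have hk' : k < 2 * l := by omega
    have hb' := betaCoeff_ne_zero hk'
    have ih' := ih hk' hb'
    have h2 : ⁅Jplus n, coupledAux n l (k + 1)⁆ = betaCoeff l ((l : ℤ) - k) • coupledAux n l k := by
      rw [coupledAux_succ, lie_smul_right, key k, inv_smul_eq_iff₀ hb', smul_smul, ← pow_two,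
        betaCoeff_sq hk'.le, ih']
    rw [h2, lie_smul_right, lie_Jminus_coupledAux n hk', smul_smul, ← pow_two, betaCoeff_sq hk'.le,
      ← add_smul]
    congr 1
    push_cast
    ring

/-! ### Powers of the raising operator -/

/-- Both sides count the (p+q+1)-element subsets of {0, ..., n+p}, sorted on the left by their
(p+1)-st smallest element a + p. The case p = q = l computes the norm of J₊^l. -/
theorem sum_choose_sub_mul_choose_add (p q n : ℕ) :
    ∑ a ∈ Finset.range (n + 1), (n - a).choose q * (a + p).choose p =
      (n + p + 1).choose (p + q + 1) := by
  induction q generalizing n with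
  | zero => simpa using Nat.sum_range_add_choose n p
  | succ q ih =>
    induction n with
    | zero => simp [Nat.choose_eq_zero_of_lt (show p + 1 < p + (q + 1) + 1 by omega)]
    | succ n ihn =>
      -- The last summand contains C(0, q+1) = 0, so Pascal's rule is needed only for a ≤ n, where n
      -- + 1 - a = (n - a) + 1 without truncation.
      rw [Finset.sum_range_succ, Nat.sub_self, Nat.choose_zero_succ, zero_mul, add_zero,
        Finset.sum_congr rfl (g := fun a => (n - a).choose q * (a + p).choose p +
          (n - a).choose (q + 1) * (a + p).choose p), Finset.sum_add_distrib, ih, ihn]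
      · rw [show n + 1 + p + 1 = (n + p + 1) + 1 by ring,
          show p + (q + 1) + 1 = (p + q + 1) + 1 by ring,
          Nat.choose_succ_succ (n + p + 1) (p + q + 1)]
      · intro a ha
        have : a < n + 1 := Finset.mem_range.1 ha
        rw [show n + 1 - a = (n - a) + 1 by omega, Nat.choose_succ_succ, add_mul]

/-- The entry is the product of the l consecutive entries of J₊ along the path from a to a + l.
Grouping the factors into binomials puts the sum of squared entries in convolution form. -/
theorem Jplus_pow_apply (n l : ℕ) (a b : Fin (n + 1)) : (Jplus n ^ l) a b =
    if (b : ℕ) = a + l then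
      Real.sqrt ((l.factorial : ℝ) ^ 2 *
        (((n - (a : ℕ)).choose l : ℕ) * (((a : ℕ) + l).choose l : ℕ)))
    else 0 := by
  induction l generalizing b with
  | zero => simp [Matrix.one_apply, Fin.ext_iff, eq_comm]
  | succ l ih =>
    split_ifs with h
    · rw [pow_succ, Matrix.mul_apply,
        Finset.sum_eq_single (⟨(a : ℕ) + l, by omega⟩ : Fin (n + 1))]
      · rw [ih, if_pos rfl]
        have hb : (b : ℕ) = ((a : ℕ) + l) + 1 := by omega
        have hbn : (a : ℕ) + l + 1 ≤ n := by omega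
        simp only [Jplus, Matrix.of_apply, if_pos hb]
        rw [← Real.sqrt_mul (by positivity)]
        congr 1
        have e1 : ((l + 1 : ℕ) : ℝ) * ((n - (a : ℕ)).choose (l + 1) : ℕ) =
            ((n - (a : ℕ)).choose l : ℕ) * ((n : ℝ) - ((a : ℕ) + l : ℕ)) := by
          have := Nat.choose_succ_right_eq (n - (a : ℕ)) l
          rw [← Nat.cast_sub (by omega), ← Nat.cast_mul, ← Nat.cast_mul, mul_comm, this,
            Nat.sub_sub]
        have e2 : ((l + 1 : ℕ) : ℝ) * (((a : ℕ) + (l + 1)).choose (l + 1) : ℕ) =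
            (((a : ℕ) + l).choose l : ℕ) * (((a : ℕ) + l : ℕ) + 1 : ℝ) := by
          have := Nat.add_one_mul_choose_eq ((a : ℕ) + l) l
          rw [← Nat.cast_mul, mul_comm, ← add_assoc, ← this]
          push_cast
          ring
        rw [Nat.factorial_succ]
        calc _ = (l.factorial : ℝ) ^ 2 * ((((n - (a : ℕ)).choose l : ℕ) *
                ((n : ℝ) - ((a : ℕ) + l : ℕ))) *
                ((((a : ℕ) + l).choose l : ℕ) * (((a : ℕ) + l : ℕ) + 1 : ℝ))) := by ring
          _ = _ := by rw [← e1, ← e2]; push_cast; ring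
      · intro c _ hc
        rw [isBand_Jplus_pow n l a c, zero_mul]
        intro h
        exact hc (Fin.ext (by simp; omega))
      · simp
    · exact isBand_Jplus_pow n (l + 1) a b (by push_cast; omega)

theorem trace_Jminus_pow_mul_Jplus_pow (n l : ℕ) :
    Matrix.trace (Jminus n ^ l * Jplus n ^ l) =
      (l.factorial : ℝ) ^ 2 * ((n + l + 1).choose (2 * l + 1) : ℕ) := by
  rw [Jminus, ← Matrix.transpose_pow, trace_transpose_mul, two_mul,
    ← sum_choose_sub_mul_choose_add, Finset.sum_range, Nat.cast_sum, Finset.mul_sum]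
  refine Finset.sum_congr rfl fun a _ => ?_
  by_cases h : (a : ℕ) + l ≤ n
  · rw [Finset.sum_eq_single (⟨(a : ℕ) + l, by omega⟩ : Fin (n + 1))]
    · rw [Jplus_pow_apply, if_pos rfl, Real.mul_self_sqrt (by positivity)]
      push_cast
      ring
    · intro c _ hc
      rw [isBand_Jplus_pow n l a c, zero_mul]
      intro h
      exact hc (Fin.ext (by simp; omega))
    · simp
  · rw [Nat.choose_eq_zero_of_lt (show n - (a : ℕ) < l by omega), zero_mul, Nat.cast_zero, mul_zero]
    refine Finset.sum_eq_zero fun c _ => ?_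
    rw [isBand_Jplus_pow n l a c (by omega), zero_mul]

theorem muNorm_pos {n l : ℕ} (hl : l ≤ n) : 0 < muNorm n l := by
  rw [muNorm, trace_Jminus_pow_mul_Jplus_pow]
  have := Nat.choose_pos (show 2 * l + 1 ≤ n + l + 1 by omega)
  positivity

theorem muNorm_sq (n l : ℕ) : muNorm n l ^ 2 = Matrix.trace (Jminus n ^ l * Jplus n ^ l) := by
  rw [muNorm, Real.sq_sqrt]
  rw [trace_Jminus_pow_mul_Jplus_pow]
  positivity

theorem trace_coupledAux_zero_self {n l : ℕ} (hl : l ≤ n) :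
    Matrix.trace ((coupledAux n l 0)ᵀ * coupledAux n l 0) = 1 := by
  have h := muNorm_pos hl
  simp only [coupledAux, Matrix.transpose_smul, smul_mul_assoc, mul_smul_comm, Matrix.trace_smul,
    Matrix.transpose_pow, smul_eq_mul]
  rw [← Jminus, ← muNorm_sq]
  field_simp
  rw [← pow_mul, mul_comm, pow_mul]
  norm_num

theorem trace_coupledAux_succ {n l l' k k' : ℕ} (hk : k < 2 * l) (hk' : k' < 2 * l') :
    betaCoeff l ((l : ℤ) - k) *
      Matrix.trace ((coupledAux n l (k + 1))ᵀ * coupledAux n l' (k' + 1)) =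
    betaCoeff l' ((l' : ℤ) - k') * Matrix.trace ((coupledAux n l k)ᵀ * coupledAux n l' k') := by
  have h := trace_lie_adjoint (coupledAux n l k) (coupledAux n l' (k' + 1))
  rwa [lie_Jminus_coupledAux n hk, lie_Jplus_coupledAux_succ n hk', Matrix.transpose_smul,
    Matrix.smul_mul, Matrix.mul_smul, Matrix.trace_smul, Matrix.trace_smul, smul_eq_mul,
    smul_eq_mul] at h

theorem trace_coupledAux_self {n l k : ℕ} (hl : l ≤ n) (hk : k ≤ 2 * l) :
    Matrix.trace ((coupledAux n l k)ᵀ * coupledAux n l k) = 1 := by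
  induction k with
  | zero => exact trace_coupledAux_zero_self hl
  | succ k ih =>
    have h := trace_coupledAux_succ (n := n) (show k < 2 * l by omega) (show k < 2 * l by omega)
    rw [ih (by omega)] at h
    exact mul_left_cancel₀ (betaCoeff_ne_zero (by omega)) h

/-- Both vectors climb their ladders together until the first is a top vector; the second is then
still a lowered vector, and the adjoint of that lowering annihilates the top. -/
theorem trace_coupledAux_of_lt {n l l' k k' : ℕ} (hk : k ≤ 2 * l) (hk' : k' ≤ 2 * l')
    (h : k < k') : Matrix.trace ((coupledAux n l k)ᵀ * coupledAux n l' k') = 0 := by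
  induction k generalizing k' with
  | zero =>
    obtain ⟨p, rfl⟩ := Nat.exists_eq_succ_of_ne_zero h.ne'
    rw [Nat.succ_eq_add_one, coupledAux_succ, mul_smul_comm, Matrix.trace_smul,
      ← Matrix.trace_transpose, Matrix.transpose_mul, Matrix.transpose_transpose,
      trace_lie_adjoint, lie_Jplus_coupledAux_zero, mul_zero, Matrix.trace_zero, smul_zero]
  | succ k ih =>
    obtain ⟨p, rfl⟩ := Nat.exists_eq_succ_of_ne_zero (show k' ≠ 0 by omega)
    have h1 := trace_coupledAux_succ (n := n) (show k < 2 * l by omega) (show p < 2 * l' by omega)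
    rw [ih (by omega) (by omega) (by omega), mul_zero] at h1
    exact (mul_eq_zero.1 h1).resolve_left (betaCoeff_ne_zero (by omega))

theorem trace_coupledAux {n l l' k k' : ℕ} (hl : l ≤ n) (hk : k ≤ 2 * l) (hk' : k' ≤ 2 * l') :
    Matrix.trace ((coupledAux n l k)ᵀ * coupledAux n l' k') =
      if l = l' ∧ k = k' then 1 else 0 := by
  split_ifs with h
  · obtain ⟨rfl, rfl⟩ := h
    exact trace_coupledAux_self hl hk
  · rcases lt_trichotomy k k' with hlt | heq | hgt
    · exact trace_coupledAux_of_lt hk hk' hlt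
    -- At equal depth k, different l give different weights l - k, hence disjoint supports.
    · exact (isBand_coupledAux n l k).trace_eq_zero (isBand_coupledAux n l' k') (by omega)
    · rw [← Matrix.trace_transpose, Matrix.transpose_mul, Matrix.transpose_transpose]
      exact trace_coupledAux_of_lt hk' hk hgt

/-! ### From the depth k below the top of a ladder to the magnetic number m = l - k. -/

theorem coupled_eq_coupledAux (n : ℕ) {l k : ℕ} (hk : k ≤ 2 * l) :
    coupled n l ((l : ℤ) - k) = coupledAux n l k := by
  rw [coupled, if_pos (by rw [abs_le]; omega)]
  congr
  omega

theorem coupled_eq_zero (n : ℕ) {l : ℕ} {m : ℤ} (h : ¬ |m| ≤ (l : ℤ)) : coupled n l m = 0 :=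
  if_neg h

theorem exists_eq_sub_of_abs_le {l : ℕ} {m : ℤ} (h : |m| ≤ (l : ℤ)) :
    ∃ k : ℕ, k ≤ 2 * l ∧ m = (l : ℤ) - k := by
  rw [abs_le] at h
  exact ⟨((l : ℤ) - m).toNat, by omega, by omega⟩

theorem isBand_coupled (n l : ℕ) (m : ℤ) : IsBand m (coupled n l m) := by
  by_cases h : |m| ≤ (l : ℤ)
  · obtain ⟨k, hk, rfl⟩ := exists_eq_sub_of_abs_le h
    rw [coupled_eq_coupledAux n hk]
    exact isBand_coupledAux n l k
  · rw [coupled_eq_zero n h]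
    intro a b _
    rfl

/-! ### The coupled basis of the complex matrices -/

/-- Labels `(l, k)` of the coupled basis: `l ≤ n` and `m = l - k` with `0 ≤ k ≤ 2l`. -/
abbrev Label (n : ℕ) : Type := Σ l : Fin (n + 1), Fin (2 * (l : ℕ) + 1)

theorem card_label (n : ℕ) : Fintype.card (Label n) = (n + 1) * (n + 1) := by
  rw [Fintype.card_sigma]
  simp only [Fintype.card_fin]
  rw [Fin.sum_univ_eq_sum_range (fun l => 2 * l + 1) (n + 1)]
  induction n + 1 with
  | zero => simp
  | succ p ih =>
    rw [Finset.sum_range_succ, ih]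
    ring

/-- The coupled basis vector with the given label. -/
noncomputable def coupledVec (n : ℕ) (i : Label n) : Matrix (Fin (n + 1)) (Fin (n + 1)) ℂ :=
  (coupledAux n i.1 i.2).map Complex.ofReal

theorem trace_transpose_map_mul_map {n : ℕ} (A B : Matrix (Fin (n + 1)) (Fin (n + 1)) ℝ) :
    Matrix.trace ((A.map Complex.ofReal)ᵀ * B.map Complex.ofReal) =
      ((Matrix.trace (Aᵀ * B) : ℝ) : ℂ) := by
  simp [trace_transpose_mul]

theorem trace_coupledVec (n : ℕ) (i i' : Label n) :
    Matrix.trace ((coupledVec n i)ᵀ * coupledVec n i') = if i = i' then 1 else 0 := by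
  obtain ⟨l, k⟩ := i
  obtain ⟨l', k'⟩ := i'
  rw [coupledVec, coupledVec, trace_transpose_map_mul_map,
    trace_coupledAux (by omega) (by simp; omega) (by simp; omega)]
  have : (((l : ℕ) = l' ∧ (k : ℕ) = k') ↔ (⟨l, k⟩ : Label n) = ⟨l', k'⟩) := by
    constructor
    · rintro ⟨h1, h2⟩
      obtain rfl := Fin.ext h1
      obtain rfl := Fin.ext h2
      rfl
    · intro h
      obtain ⟨rfl, h2⟩ := Sigma.mk.inj_iff.1 h
      obtain rfl := eq_of_heq h2
      exact ⟨rfl, rfl⟩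
  simp only [this]
  split_ifs <;> simp

theorem linearIndependent_coupledVec (n : ℕ) : LinearIndependent ℂ (coupledVec n) := by
  rw [Fintype.linearIndependent_iff]
  intro g hg i
  have h := congrArg (fun A => Matrix.trace ((coupledVec n i)ᵀ * A)) hg
  simpa [Finset.mul_sum, Matrix.trace_sum, trace_coupledVec] using h

/-- The coupled basis. -/
noncomputable def coupledBasis (n : ℕ) :
    Module.Basis (Label n) ℂ (Matrix (Fin (n + 1)) (Fin (n + 1)) ℂ) :=
  haveI : Nonempty (Label n) := ⟨⟨0, 0⟩⟩
  basisOfLinearIndependentOfCardEqFinrank (linearIndependent_coupledVec n)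
    (by rw [card_label, Module.finrank_matrix]; simp)

theorem coupledBasis_apply (n : ℕ) (i : Label n) : coupledBasis n i = coupledVec n i := by
  simp [coupledBasis]

/-- The basis matrices are real, so the transpose in the pairing agrees with the adjoint and the
bilinear trace form gives the Hilbert–Schmidt coordinates. -/
theorem eq_sum_coupledVec (n : ℕ) (P : Matrix (Fin (n + 1)) (Fin (n + 1)) ℂ) :
    P = ∑ i, Matrix.trace ((coupledVec n i)ᵀ * P) • coupledVec n i := by
  conv_lhs => rw [← (coupledBasis n).sum_repr P]
  refine Finset.sum_congr rfl fun i _ => ?_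
  rw [coupledBasis_apply]
  congr 1
  conv_rhs => rw [← (coupledBasis n).sum_repr P]
  simp [Finset.mul_sum, Matrix.trace_sum, coupledBasis_apply, trace_coupledVec]

theorem coupledC_eq_coupledVec {n l k : ℕ} (hl : l ≤ n) (hk : k ≤ 2 * l) :
    coupledC n l ((l : ℤ) - k) =
      coupledVec n ⟨⟨l, Nat.lt_succ_of_le hl⟩, ⟨k, Nat.lt_succ_of_le hk⟩⟩ := by
  rw [coupledC, coupled_eq_coupledAux n hk]
  rfl

/-! ### Products of coupled basis vectors -/

theorem clebschGordan_eq (n : ℕ) (a b : Fin (n + 1)) (l : ℕ) (m : ℤ) :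
    clebschGordan n a b l m = (-1) ^ (n - (b : ℕ)) * coupled n l m a (Fin.rev b) := by
  rw [clebschGordan, uncoupled, trace_transpose_mul, Finset.sum_eq_single a,
    Finset.sum_eq_single (Fin.rev b)]
  · rw [Matrix.single_apply_same, mul_comm]
  · intro c _ hc
    rw [Matrix.single_apply_of_ne, mul_zero]
    exact fun h => hc h.2.symm
  · simp
  · intro c _ hc
    refine Finset.sum_eq_zero fun d _ => ?_
    rw [Matrix.single_apply_of_ne, mul_zero]
    exact fun h => hc h.1.symm
  · simp

/-- Reversing the indices of μ₂ and μ₃ turns the Clebsch–Gordan coefficients into signed matrix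
entries. The sign (-1)^(j+μ₂) cancels against that of the first coefficient, and the signs of the
other two cancel each other. -/
theorem productCoeff_eq_trace (n l₁ l₂ l : ℕ) (m₁ m₂ m : ℤ) :
    productCoeff n l₁ l₂ l m₁ m₂ m =
      Matrix.trace ((coupled n l m)ᵀ * (coupled n l₁ m₁ * coupled n l₂ m₂)) := by
  rw [productCoeff, trace_transpose_mul]
  refine Finset.sum_congr rfl fun a _ => ?_
  rw [Finset.sum_comm, ← Equiv.sum_comp Fin.revPerm]
  refine Finset.sum_congr rfl fun c _ => ?_
  rw [Matrix.mul_apply, Finset.mul_sum, ← Equiv.sum_comp Fin.revPerm]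
  refine Finset.sum_congr rfl fun b _ => ?_
  have hs : ∀ p : ℕ, ((-1 : ℝ) ^ p) * (-1) ^ p = 1 := fun p => by rw [← mul_pow]; norm_num
  simp only [clebschGordan_eq, Fin.revPerm_apply, Fin.rev_rev]
  linear_combination (coupled n l₁ m₁ a b * coupled n l₂ m₂ b c * coupled n l m a c *
    ((-1) ^ (n - (Fin.rev c : ℕ)) * (-1) ^ (n - (Fin.rev c : ℕ)))) * hs (n - (Fin.rev b : ℕ)) +
    (coupled n l₁ m₁ a b * coupled n l₂ m₂ b c * coupled n l m a c) * hs (n - (Fin.rev c : ℕ))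

theorem wignerProduct_eq (n l₁ l₂ l : ℕ) (m₁ m₂ m : ℤ) :
    wignerProduct n l₁ l₂ l m₁ m₂ (-m) =
      (-1) ^ ((n : ℤ) + m) * productCoeff n l₁ l₂ l m₁ m₂ m := by
  rw [wignerProduct, neg_neg, sub_neg_eq_add]

/-- The product lies on the off-diagonal m₁ + m₂, so each l contributes at most the single basis
vector of that weight; for l < |m₁ + m₂| the default value of `coupledC` makes the term zero. -/
theorem coupledC_mul_coupledC (n l₁ l₂ : ℕ) (m₁ m₂ : ℤ) :
    coupledC n l₁ m₁ * coupledC n l₂ m₂ =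
      ∑ l ∈ Finset.range (n + 1),
        ((productCoeff n l₁ l₂ l m₁ m₂ (m₁ + m₂) : ℝ) : ℂ) • coupledC n l (m₁ + m₂) := by
  have hmul : coupledC n l₁ m₁ * coupledC n l₂ m₂ =
      (coupled n l₁ m₁ * coupled n l₂ m₂).map Complex.ofReal :=
    (Matrix.map_mul (f := Complex.ofRealHom)).symm
  rw [hmul, eq_sum_coupledVec n ((coupled n l₁ m₁ * coupled n l₂ m₂).map Complex.ofReal),
    Fintype.sum_sigma, Finset.sum_range]
  refine Finset.sum_congr rfl fun l _ => ?_
  simp only [coupledVec, trace_transpose_map_mul_map]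
  have hband := (isBand_coupled n l₁ m₁).mul (isBand_coupled n l₂ m₂)
  by_cases h : |m₁ + m₂| ≤ ((l : ℕ) : ℤ)
  · obtain ⟨k, hk, hm⟩ := exists_eq_sub_of_abs_le h
    rw [Finset.sum_eq_single (⟨k, Nat.lt_succ_of_le hk⟩ : Fin (2 * (l : ℕ) + 1))]
    · rw [productCoeff_eq_trace, coupledC, hm, coupled_eq_coupledAux n hk]
    · intro k' _ hk'
      rw [(isBand_coupledAux n l k').trace_eq_zero hband, Complex.ofReal_zero, zero_smul]
      intro h'
      exact hk' (Fin.ext (by simp; omega))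
    · simp
  · rw [coupledC, coupled_eq_zero n h, Matrix.map_zero _ Complex.ofReal_zero, smul_zero]
    refine Finset.sum_eq_zero fun k _ => ?_
    rw [(isBand_coupledAux n l k).trace_eq_zero hband, Complex.ofReal_zero, zero_smul]
    rintro h'
    apply h
    rw [abs_le]
    omega

/-! ### Symbols as bihomogeneous polynomials

The variables `X 0, X 1, X 2, X 3` stand for `z̄₁, z̄₂, z₁, z₂`. -/

/-- The components of the coherent state vector as polynomials in the variables `i` and `j`. -/
noncomputable def phiPoly (n : ℕ) (i j : Fin 4) (k : Fin (n + 1)) : MvPolynomial (Fin 4) ℂ :=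
  MvPolynomial.C ((Real.sqrt (n.choose (k : ℕ) : ℝ) : ℝ) : ℂ) *
    (MvPolynomial.X i ^ (n - (k : ℕ)) * MvPolynomial.X j ^ (k : ℕ))

/-- The Berezin symbol of a matrix, as a polynomial in `z̄₁, z̄₂, z₁, z₂`. -/
noncomputable def symbPoly (n : ℕ) :
    Matrix (Fin (n + 1)) (Fin (n + 1)) ℂ →ₗ[ℂ] MvPolynomial (Fin 4) ℂ where
  toFun P := ∑ a, ∑ b, P a b • (phiPoly n 0 1 a * phiPoly n 2 3 b)
  map_add' P Q := by
    simp only [Matrix.add_apply, add_smul, Finset.sum_add_distrib]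
  map_smul' r P := by
    simp only [Matrix.smul_apply, smul_assoc, Finset.smul_sum, RingHom.id_apply]

theorem symbPoly_apply (n : ℕ) (P : Matrix (Fin (n + 1)) (Fin (n + 1)) ℂ) :
    symbPoly n P = ∑ a, ∑ b, P a b • (phiPoly n 0 1 a * phiPoly n 2 3 b) := rfl

theorem phiPoly_rev (n : ℕ) (i j : Fin 4) (k : Fin (n + 1)) :
    phiPoly n i j (Fin.rev k) = phiPoly n j i k := by
  have hk : (k : ℕ) ≤ n := Nat.lt_succ_iff.1 k.2
  rw [phiPoly, phiPoly, Fin.val_rev, show n + 1 - ((k : ℕ) + 1) = n - k by omega,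
    Nat.choose_symm hk, Nat.sub_sub_self hk, mul_comm (MvPolynomial.X i ^ _)]

/-- J₊ acts on the coherent vector as the vector field z₂ ∂/∂z₁, or its z̄ analogue. The weights
√(binom n k) are exactly those that turn the entries of J₊ into the integer factors produced by
differentiation. -/
theorem sum_Jplus_smul_phiPoly (n : ℕ) {i j : Fin 4} (hij : i ≠ j) (c : Fin (n + 1)) :
    ∑ b, ((Jplus n c b : ℝ) : ℂ) • phiPoly n i j b =
      MvPolynomial.X j * MvPolynomial.pderiv i (phiPoly n i j c) := by
  have hc : (c : ℕ) ≤ n := Nat.lt_succ_iff.1 c.2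
  have hder : MvPolynomial.X j * MvPolynomial.pderiv i (phiPoly n i j c) =
      MvPolynomial.C (((Real.sqrt (n.choose (c : ℕ) : ℝ) * ((n - (c : ℕ) : ℕ) : ℝ) : ℝ)) : ℂ) *
        (MvPolynomial.X i ^ (n - (c : ℕ) - 1) * MvPolynomial.X j ^ ((c : ℕ) + 1)) := by
    rw [phiPoly, MvPolynomial.pderiv_C_mul]
    simp only [Derivation.leibniz, Derivation.leibniz_pow, MvPolynomial.pderiv_X_self,
      MvPolynomial.pderiv_X_of_ne hij.symm, smul_eq_mul, nsmul_eq_mul,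
      smul_zero, mul_zero, zero_add, mul_one, Complex.ofReal_mul, map_mul, Complex.ofReal_natCast,
      map_natCast]
    ring
  rw [hder]
  by_cases hn : (c : ℕ) = n
  · rw [hn, Nat.sub_self, Nat.cast_zero, mul_zero, Complex.ofReal_zero, map_zero, zero_mul]
    refine Finset.sum_eq_zero fun b _ => ?_
    rw [isBand_Jplus n c b (by omega), Complex.ofReal_zero, zero_smul]
  · rw [Finset.sum_eq_single (⟨(c : ℕ) + 1, by omega⟩ : Fin (n + 1))]
    · simp only [Jplus, Matrix.of_apply, if_true, phiPoly, MvPolynomial.smul_eq_C_mul]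
      rw [← mul_assoc, ← map_mul, ← Complex.ofReal_mul, Nat.sub_sub]
      congr 3
      rw [← Nat.cast_sub hc, ← Real.sqrt_mul (by positivity),
        ← Real.sqrt_sq (Nat.cast_nonneg (n - (c : ℕ))), ← Real.sqrt_mul (by positivity)]
      congr 1
      have h := Nat.choose_succ_right_eq n c
      have h' : ((n.choose ((c : ℕ) + 1) : ℕ) : ℝ) * ((c : ℕ) + 1) =
          (n.choose c : ℕ) * ((n - (c : ℕ) : ℕ) : ℝ) := by exact_mod_cast h
      rw [Real.sqrt_sq (Nat.cast_nonneg _)]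
      linear_combination ((n - (c : ℕ) : ℕ) : ℝ) * h'
    · intro b _ hb
      rw [isBand_Jplus n c b, Complex.ofReal_zero, zero_smul]
      intro h
      exact hb (Fin.ext (by simp; omega))
    · simp

/-- Reversing the basis exchanges J₊ with J₋ and z₁ with z₂, so the action of J₋ on coherent vectors
follows from that of J₊. -/
theorem Jminus_apply_eq_Jplus_rev (n : ℕ) (a b : Fin (n + 1)) :
    Jminus n a b = Jplus n (Fin.rev a) (Fin.rev b) := by
  have ha : (a : ℕ) ≤ n := Nat.lt_succ_iff.1 a.2
  have hb : (b : ℕ) ≤ n := Nat.lt_succ_iff.1 b.2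
  simp only [Jminus, Jplus, Matrix.transpose_apply, Matrix.of_apply, Fin.val_rev]
  by_cases h : (a : ℕ) = b + 1
  · rw [if_pos h, if_pos (by omega), show n + 1 - ((a : ℕ) + 1) = n - a by omega, Nat.cast_sub ha, h]
    congr 1
    push_cast
    ring
  · rw [if_neg h, if_neg (by omega)]

theorem sum_Jminus_smul_phiPoly (n : ℕ) {i j : Fin 4} (hij : i ≠ j) (c : Fin (n + 1)) :
    ∑ b, ((Jminus n c b : ℝ) : ℂ) • phiPoly n i j b =
      MvPolynomial.X i * MvPolynomial.pderiv j (phiPoly n i j c) := by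
  rw [← phiPoly_rev n j i c, ← sum_Jplus_smul_phiPoly n hij.symm, ← Equiv.sum_comp Fin.revPerm]
  refine Finset.sum_congr rfl fun b _ => ?_
  rw [Fin.revPerm_apply, Jminus_apply_eq_Jplus_rev, Fin.rev_rev, phiPoly_rev]

theorem pderiv_phiPoly_of_ne (n : ℕ) {i j k : Fin 4} (hi : i ≠ k) (hj : j ≠ k) (a : Fin (n + 1)) :
    MvPolynomial.pderiv k (phiPoly n i j a) = 0 := by
  simp [phiPoly, Derivation.leibniz, Derivation.leibniz_pow, MvPolynomial.pderiv_X_of_ne hi,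
    MvPolynomial.pderiv_X_of_ne hj]

theorem symbPoly_mul_right {n : ℕ} (P J : Matrix (Fin (n + 1)) (Fin (n + 1)) ℂ) (i j : Fin 4)
    (hi : i = 2 ∨ i = 3)
    (h : ∀ c, ∑ b, J c b • phiPoly n 2 3 b =
      MvPolynomial.X j * MvPolynomial.pderiv i (phiPoly n 2 3 c)) :
    symbPoly n (P * J) = MvPolynomial.X j * MvPolynomial.pderiv i (symbPoly n P) := by
  have h0 : ∀ a, MvPolynomial.pderiv i (phiPoly n 0 1 a) = 0 := fun a =>
    pderiv_phiPoly_of_ne n (by rcases hi with rfl | rfl <;> decide)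
      (by rcases hi with rfl | rfl <;> decide) a
  simp only [symbPoly_apply, map_sum, Derivation.map_smul, Derivation.leibniz, h0, mul_zero,
    add_zero, Finset.mul_sum, smul_eq_mul]
  refine Finset.sum_congr rfl fun a _ => ?_
  have : ∀ c, MvPolynomial.X j * P a c • (phiPoly n 0 1 a *
      MvPolynomial.pderiv i (phiPoly n 2 3 c)) =
      ∑ b, (P a c * J c b) • (phiPoly n 0 1 a * phiPoly n 2 3 b) := by
    intro c
    calc _ = P a c • (phiPoly n 0 1 a *
          (MvPolynomial.X j * MvPolynomial.pderiv i (phiPoly n 2 3 c))) := by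
            rw [mul_smul_comm, mul_left_comm]
      _ = _ := by
            rw [← h, Finset.mul_sum, Finset.smul_sum]
            simp only [mul_smul_comm, smul_smul]
  simp only [this, Matrix.mul_apply, Finset.sum_smul]
  exact Finset.sum_comm

theorem symbPoly_mul_left {n : ℕ} (P J : Matrix (Fin (n + 1)) (Fin (n + 1)) ℂ) (i j : Fin 4)
    (hi : i = 0 ∨ i = 1)
    (h : ∀ c, ∑ a, J a c • phiPoly n 0 1 a =
      MvPolynomial.X j * MvPolynomial.pderiv i (phiPoly n 0 1 c)) :
    symbPoly n (J * P) = MvPolynomial.X j * MvPolynomial.pderiv i (symbPoly n P) := by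
  have h0 : ∀ a, MvPolynomial.pderiv i (phiPoly n 2 3 a) = 0 := fun a =>
    pderiv_phiPoly_of_ne n (by rcases hi with rfl | rfl <;> decide)
      (by rcases hi with rfl | rfl <;> decide) a
  simp only [symbPoly_apply, map_sum, Derivation.map_smul, Derivation.leibniz, h0, mul_zero,
    zero_add, Finset.mul_sum, smul_eq_mul]
  rw [Finset.sum_comm]
  conv_rhs => rw [Finset.sum_comm]
  refine Finset.sum_congr rfl fun b _ => ?_
  have : ∀ c, MvPolynomial.X j * P c b • (phiPoly n 2 3 b *
      MvPolynomial.pderiv i (phiPoly n 0 1 c)) =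
      ∑ a, (J a c * P c b) • (phiPoly n 0 1 a * phiPoly n 2 3 b) := by
    intro c
    calc _ = P c b • ((MvPolynomial.X j * MvPolynomial.pderiv i (phiPoly n 0 1 c)) *
          phiPoly n 2 3 b) := by
            rw [mul_smul_comm, mul_left_comm, mul_comm (phiPoly n 2 3 b)]
      _ = _ := by
            rw [← h, Finset.sum_mul, Finset.smul_sum]
            simp only [smul_mul_assoc, smul_smul, mul_comm]
  simp only [this, Matrix.mul_apply, Finset.sum_smul]
  exact Finset.sum_comm

theorem symbPoly_mul_Jplus {n : ℕ} (P : Matrix (Fin (n + 1)) (Fin (n + 1)) ℂ) :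
    symbPoly n (P * (Jplus n).map Complex.ofReal) =
      MvPolynomial.X 3 * MvPolynomial.pderiv 2 (symbPoly n P) :=
  symbPoly_mul_right P _ 2 3 (by simp) fun c => by
    simpa using sum_Jplus_smul_phiPoly n (show (2 : Fin 4) ≠ 3 by decide) c

theorem symbPoly_mul_Jminus {n : ℕ} (P : Matrix (Fin (n + 1)) (Fin (n + 1)) ℂ) :
    symbPoly n (P * (Jminus n).map Complex.ofReal) =
      MvPolynomial.X 2 * MvPolynomial.pderiv 3 (symbPoly n P) :=
  symbPoly_mul_right P _ 3 2 (by simp) fun c => by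
    simpa using sum_Jminus_smul_phiPoly n (show (2 : Fin 4) ≠ 3 by decide) c

theorem symbPoly_Jminus_mul {n : ℕ} (P : Matrix (Fin (n + 1)) (Fin (n + 1)) ℂ) :
    symbPoly n ((Jminus n).map Complex.ofReal * P) =
      MvPolynomial.X 1 * MvPolynomial.pderiv 0 (symbPoly n P) :=
  symbPoly_mul_left P _ 0 1 (by simp) fun c => by
    simpa [Jminus] using sum_Jplus_smul_phiPoly n (show (0 : Fin 4) ≠ 1 by decide) c

/-- The derivation of polynomials in `z̄₁, z̄₂, z₁, z₂` induced by the commutator with `J₋`. -/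
noncomputable def lowerDer : Derivation ℂ (MvPolynomial (Fin 4) ℂ) (MvPolynomial (Fin 4) ℂ) :=
  (MvPolynomial.X 1 : MvPolynomial (Fin 4) ℂ) • MvPolynomial.pderiv 0 -
    (MvPolynomial.X 2 : MvPolynomial (Fin 4) ℂ) • MvPolynomial.pderiv 3

theorem lowerDer_apply (p : MvPolynomial (Fin 4) ℂ) : lowerDer p =
    MvPolynomial.X 1 * MvPolynomial.pderiv 0 p - MvPolynomial.X 2 * MvPolynomial.pderiv 3 p := rfl

theorem lowerDer_X (i : Fin 4) : lowerDer (MvPolynomial.X i) =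
    ![MvPolynomial.X 1, 0, 0, -MvPolynomial.X 2] i := by
  fin_cases i <;> simp [lowerDer_apply, MvPolynomial.pderiv_X]

/-- The invariant form `|z₁|² + |z₂|²`. -/
noncomputable def normPoly : MvPolynomial (Fin 4) ℂ :=
  MvPolynomial.X 0 * MvPolynomial.X 2 + MvPolynomial.X 1 * MvPolynomial.X 3

theorem lowerDer_normPoly : lowerDer normPoly = 0 := by
  simp [normPoly, Derivation.leibniz, lowerDer_X]
  ring

theorem symbPoly_one (n : ℕ) : symbPoly n 1 = normPoly ^ n := by
  rw [normPoly, add_comm (MvPolynomial.X 0 * _), add_pow, symbPoly_apply, Finset.sum_range]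
  refine Finset.sum_congr rfl fun a _ => ?_
  rw [Finset.sum_eq_single a]
  · rw [Matrix.one_apply_eq, one_smul, phiPoly, phiPoly, mul_mul_mul_comm, ← map_mul,
      ← Complex.ofReal_mul, Real.mul_self_sqrt (by positivity), Complex.ofReal_natCast, map_natCast]
    ring
  · intro b _ hb
    rw [Matrix.one_apply_ne hb.symm, zero_smul]
  · simp

/-- Right multiplication by J₊ applies z₂ ∂/∂z₁, which annihilates z̄₁z₂ and sends N to z̄₁z₂.
Starting from the symbol N^n of the identity, each step trades one factor N for z̄₁z₂. -/
theorem symbPoly_Jplus_pow (n l : ℕ) : symbPoly n ((Jplus n ^ l).map Complex.ofReal) =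
    MvPolynomial.C (n.descFactorial l : ℂ) *
      ((MvPolynomial.X 0 * MvPolynomial.X 3) ^ l * normPoly ^ (n - l)) := by
  induction l with
  | zero =>
    rw [pow_zero, Matrix.map_one _ Complex.ofReal_zero Complex.ofReal_one, symbPoly_one]
    simp
  | succ l ih =>
    have h1 : (Jplus n ^ (l + 1)).map Complex.ofReal =
        (Jplus n ^ l).map Complex.ofReal * (Jplus n).map Complex.ofReal := by
      rw [pow_succ]
      exact Matrix.map_mul (f := Complex.ofRealHom)
    have h2 : MvPolynomial.pderiv 2 normPoly = MvPolynomial.X 0 := by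
      simp [normPoly, Derivation.leibniz, MvPolynomial.pderiv_X]
    have h3 : MvPolynomial.pderiv (2 : Fin 4)
        ((MvPolynomial.X 0 * MvPolynomial.X 3 : MvPolynomial (Fin 4) ℂ) ^ l) = 0 := by
      simp [Derivation.leibniz, Derivation.leibniz_pow, MvPolynomial.pderiv_X]
    rw [h1, symbPoly_mul_Jplus, ih, MvPolynomial.pderiv_C_mul, Derivation.leibniz, h3, smul_zero,
      add_zero, Derivation.leibniz_pow, h2, Nat.descFactorial_succ, Nat.sub_sub]
    simp only [smul_eq_mul, nsmul_eq_mul, Nat.cast_mul, map_mul, map_natCast]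
    ring

/-! ### The Hopf map on polynomials -/

/-- The pullback of polynomials in `x, y, z` along the Hopf map. -/
noncomputable def hopfHom : MvPolynomial (Fin 3) ℂ →ₐ[ℂ] MvPolynomial (Fin 4) ℂ :=
  MvPolynomial.aeval ![MvPolynomial.X 0 * MvPolynomial.X 3 + MvPolynomial.X 2 * MvPolynomial.X 1,
    MvPolynomial.C (-Complex.I) *
      (MvPolynomial.X 0 * MvPolynomial.X 3 - MvPolynomial.X 2 * MvPolynomial.X 1),
    MvPolynomial.X 0 * MvPolynomial.X 2 - MvPolynomial.X 1 * MvPolynomial.X 3]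

theorem C_I_mul_C_I {σ : Type*} :
    (MvPolynomial.C Complex.I : MvPolynomial σ ℂ) * MvPolynomial.C Complex.I = -1 := by
  rw [← map_mul, Complex.I_mul_I, map_neg, map_one]

theorem hopfHom_C (r : ℂ) : hopfHom (MvPolynomial.C r) = MvPolynomial.C r := by
  simp [hopfHom, MvPolynomial.algebraMap_eq]

theorem JminusPoly_eq (p : MvPolynomial (Fin 3) ℂ) : JminusPoly p =
    (MvPolynomial.X 0 - MvPolynomial.C Complex.I * MvPolynomial.X 1) * MvPolynomial.pderiv 2 p -
      MvPolynomial.X 2 *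
        (MvPolynomial.pderiv 0 p - MvPolynomial.C Complex.I * MvPolynomial.pderiv 1 p) := by
  simp only [JminusPoly, map_neg]
  linear_combination (MvPolynomial.X 2 * MvPolynomial.pderiv 0 p -
    MvPolynomial.X 0 * MvPolynomial.pderiv 2 p) * C_I_mul_C_I (σ := Fin 3)

theorem JminusPoly_mul (p q : MvPolynomial (Fin 3) ℂ) :
    JminusPoly (p * q) = JminusPoly p * q + p * JminusPoly q := by
  simp only [JminusPoly_eq, Derivation.leibniz, smul_eq_mul]
  ring

/-- Infinitesimal equivariance of the Hopf map. Both sides are derivations along `hopfHom`, so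
agreement on constants and on x, y, z suffices. -/
theorem hopfHom_JminusPoly (p : MvPolynomial (Fin 3) ℂ) :
    hopfHom (JminusPoly p) = lowerDer (hopfHom p) := by
  induction p using MvPolynomial.induction_on with
  | C r => simp [JminusPoly_eq, hopfHom, MvPolynomial.algebraMap_eq]
  | add p q hp hq =>
    have : JminusPoly (p + q) = JminusPoly p + JminusPoly q := by
      simp only [JminusPoly_eq, map_add]
      ring
    rw [this, map_add, map_add, map_add, hp, hq]
  | mul_X p i hp =>
    have hX : hopfHom (JminusPoly (MvPolynomial.X i)) = lowerDer (hopfHom (MvPolynomial.X i)) := by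
      have hI := C_I_mul_C_I (σ := Fin 4)
      fin_cases i
      · simp [JminusPoly_eq, MvPolynomial.pderiv_X, hopfHom, Derivation.leibniz,
          lowerDer_X]
        ring
      · simp [JminusPoly_eq, MvPolynomial.pderiv_X, hopfHom, Derivation.leibniz,
          lowerDer_X, MvPolynomial.algebraMap_eq, lowerDer_apply (MvPolynomial.C _)]
        ring
      · simp [JminusPoly_eq, MvPolynomial.pderiv_X, hopfHom, Derivation.leibniz,
          lowerDer_X, MvPolynomial.algebraMap_eq]
        linear_combination (MvPolynomial.X 0 * MvPolynomial.X 3 -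
          MvPolynomial.X 2 * MvPolynomial.X 1) * hI
    rw [JminusPoly_mul, map_add, map_mul, map_mul, map_mul, hp, hX, Derivation.leibniz, smul_eq_mul,
      smul_eq_mul]
    ring

theorem hopfHom_harmonicAux_zero (l : ℕ) : hopfHom (harmonicAux l 0) =
    MvPolynomial.C (((-1) ^ l / lambdaNorm l * 2 ^ l : ℝ) : ℂ) *
      (MvPolynomial.X 0 * MvPolynomial.X 3) ^ l := by
  have h : hopfHom (MvPolynomial.X 0 + MvPolynomial.C Complex.I * MvPolynomial.X 1) =
      MvPolynomial.C 2 * (MvPolynomial.X 0 * MvPolynomial.X 3) := by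
    have h2 : (MvPolynomial.C 2 : MvPolynomial (Fin 4) ℂ) = 2 := map_ofNat _ 2
    rw [map_add, map_mul, hopfHom_C, h2]
    simp only [hopfHom, MvPolynomial.aeval_X, Matrix.cons_val_zero, Matrix.cons_val_one, map_neg]
    linear_combination -(MvPolynomial.X 0 * MvPolynomial.X 3 -
      MvPolynomial.X 2 * MvPolynomial.X 1) * C_I_mul_C_I (σ := Fin 4)
  rw [harmonicAux, map_mul, map_pow, hopfHom_C, h, mul_pow, ← map_pow, ← mul_assoc, ← map_mul]
  congr 3
  push_cast
  ring

/-! ### Symbols of the coupled basis -/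

theorem cast_choose_mul {n k : ℕ} (h : k ≤ n) :
    (n.choose k : ℝ) * ((k.factorial : ℝ) * ((n - k).factorial : ℝ)) = n.factorial := by
  rw [← mul_assoc]
  exact_mod_cast Nat.choose_mul_factorial_mul_factorial h

theorem berezinNumber_pos {n l : ℕ} (hl : l ≤ n) : 0 < berezinNumber n l := by
  have h1 := Nat.choose_pos hl
  have h2 := Nat.choose_pos (show l ≤ n + l + 1 by omega)
  rw [berezinNumber]
  positivity

/-- This comparison of highest weight coefficients is where the numbers b_l come from; the factor
2^l enters through x + iy = 2 z̄₁z₂. -/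
theorem sqrt_mul_descFactorial_div_muNorm {n l : ℕ} (hl : l ≤ n) :
    Real.sqrt ((n : ℝ) + 1) * (((-1) ^ l / muNorm n l) * (n.descFactorial l : ℝ)) =
      berezinNumber n l * ((-1) ^ l / lambdaNorm l * 2 ^ l) := by
  have hA := Nat.choose_pos hl
  have hB := Nat.choose_pos (show l ≤ n + l + 1 by omega)
  have hC := Nat.choose_pos (show 2 * l + 1 ≤ n + l + 1 by omega)
  have hmu : muNorm n l = l.factorial * Real.sqrt ((n + l + 1).choose (2 * l + 1) : ℕ) := by
    rw [muNorm, trace_Jminus_pow_mul_Jplus_pow, Real.sqrt_mul (by positivity),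
      Real.sqrt_sq (by positivity)]
  have key : Real.sqrt ((n : ℝ) + 1) * (n.descFactorial l : ℝ) *
      Real.sqrt ((n + l + 1).choose l : ℝ) =
      Real.sqrt (n.choose l : ℝ) * Real.sqrt ((2 * l + 1).factorial : ℝ) *
        Real.sqrt ((n + l + 1).choose (2 * l + 1) : ℝ) := by
    rw [← Real.sqrt_sq (show (0 : ℝ) ≤ n.descFactorial l by positivity),
      ← Real.sqrt_mul (by positivity), ← Real.sqrt_mul (by positivity),
      ← Real.sqrt_mul (by positivity), ← Real.sqrt_mul (by positivity)]
    congr 1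
    have e1 := cast_choose_mul hl
    have e2 := cast_choose_mul (show l ≤ n + l + 1 by omega)
    have e3 := cast_choose_mul (show 2 * l + 1 ≤ n + l + 1 by omega)
    have e4 : ((n - l).factorial : ℝ) * n.descFactorial l = n.factorial := by
      exact_mod_cast Nat.factorial_mul_descFactorial hl
    rw [show n + l + 1 - l = n + 1 by omega, Nat.factorial_succ] at e2
    rw [show n + l + 1 - (2 * l + 1) = n - l by omega] at e3
    push_cast at e2
    have f1 : ((l.factorial : ℝ)) ≠ 0 := by positivity
    have f2 : (((n - l).factorial : ℝ)) ≠ 0 := by positivity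
    have f3 : ((n.factorial : ℝ)) ≠ 0 := by positivity
    apply mul_left_cancel₀ (mul_ne_zero (mul_ne_zero f1 f3) (mul_ne_zero f2 f2))
    calc _ = ((n + l + 1).choose l : ℝ) * (l.factorial * ((n + 1) * n.factorial)) *
          (((n - l).factorial : ℝ) * n.descFactorial l) ^ 2 := by ring
      _ = (n.choose l * (l.factorial * ((n - l).factorial : ℝ))) * n.factorial *
          (((n + l + 1).choose (2 * l + 1) : ℝ) * ((2 * l + 1).factorial * (n - l).factorial)) := by
          rw [e1, e2, e3, e4]
          ring
      _ = _ := by ring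
  rw [hmu, berezinNumber, lambdaNorm]
  field_simp
  linear_combination key

theorem map_smul_lie_Jminus {n : ℕ} (r : ℝ) (A : Matrix (Fin (n + 1)) (Fin (n + 1)) ℝ) :
    (r • ⁅Jminus n, A⁆).map Complex.ofReal = (r : ℂ) •
      ((Jminus n).map Complex.ofReal * A.map Complex.ofReal -
        A.map Complex.ofReal * (Jminus n).map Complex.ofReal) := by
  rw [Ring.lie_def]
  ext a b
  simp [Matrix.mul_apply]

/-- The top vectors match up to the constant b_l. The lowering derivation annihilates N and
intertwines with the lowering of harmonics, so the same constant persists down the ladder. -/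
theorem symbPoly_coupledAux {n l : ℕ} (hl : l ≤ n) (k : ℕ) :
    symbPoly n (((Real.sqrt ((n : ℝ) + 1) : ℝ) : ℂ) • (coupledAux n l k).map Complex.ofReal) =
      MvPolynomial.C ((berezinNumber n l : ℝ) : ℂ) *
        (hopfHom (harmonicAux l k) * normPoly ^ (n - l)) := by
  induction k with
  | zero =>
    have h : (coupledAux n l 0).map Complex.ofReal =
        (((-1) ^ l / muNorm n l : ℝ) : ℂ) • (Jplus n ^ l).map Complex.ofReal := by
      ext a b
      simp [coupledAux]
    rw [h, smul_smul, map_smul, symbPoly_Jplus_pow, hopfHom_harmonicAux_zero,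
      MvPolynomial.smul_eq_C_mul, ← mul_assoc, ← mul_assoc, ← mul_assoc, ← mul_assoc, ← map_mul,
      ← map_mul, ← Complex.ofReal_mul, ← Complex.ofReal_mul, ← Complex.ofReal_natCast,
      ← Complex.ofReal_mul, mul_assoc (Real.sqrt _), sqrt_mul_descFactorial_div_muNorm hl]
  | succ k ih =>
    rw [coupledAux_succ, map_smul_lie_Jminus, smul_comm, map_smul, smul_sub, ← mul_smul_comm,
      ← smul_mul_assoc, map_sub, symbPoly_Jminus_mul, symbPoly_mul_Jminus, ← lowerDer_apply, ih,
      harmonicAux, map_mul hopfHom, hopfHom_C, hopfHom_JminusPoly, ← MvPolynomial.smul_eq_C_mul,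
      ← MvPolynomial.smul_eq_C_mul, ← MvPolynomial.smul_eq_C_mul, Derivation.map_smul,
      Derivation.leibniz, Derivation.leibniz_pow, lowerDer_normPoly]
    simp only [mul_zero, smul_zero, zero_add, smul_eq_mul, smul_mul_assoc]
    rw [smul_comm, mul_comm (normPoly ^ _)]

/-! ### Values of symbols -/

/-- Evaluation of polynomials in `z̄₁, z̄₂, z₁, z₂` at a vector `(z₁, z₂)`. -/
noncomputable def evalAt (z₁ z₂ : ℂ) : MvPolynomial (Fin 4) ℂ →ₐ[ℂ] ℂ :=
  MvPolynomial.aeval ![(starRingEnd ℂ) z₁, (starRingEnd ℂ) z₂, z₁, z₂]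

theorem evalAt_symbPoly (n : ℕ) (z₁ z₂ : ℂ) (P : Matrix (Fin (n + 1)) (Fin (n + 1)) ℂ) :
    evalAt z₁ z₂ (symbPoly n P) = star (coherent n z₁ z₂) ⬝ᵥ (P *ᵥ coherent n z₁ z₂) := by
  simp only [symbPoly_apply, map_sum, map_smul, map_mul, dotProduct, Matrix.mulVec, Pi.star_apply,
    Finset.mul_sum]
  refine Finset.sum_congr rfl fun a _ => Finset.sum_congr rfl fun b _ => ?_
  simp [phiPoly, coherent, evalAt]
  ring

theorem evalAt_normPoly {z₁ z₂ : ℂ} (hz : ‖z₁‖ ^ 2 + ‖z₂‖ ^ 2 = 1) :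
    evalAt z₁ z₂ normPoly = 1 := by
  simp only [evalAt, normPoly, map_add, map_mul, MvPolynomial.aeval_X, Matrix.cons_val_zero,
    Matrix.cons_val_one, Matrix.cons_val]
  rw [Complex.conj_mul', Complex.conj_mul']
  exact_mod_cast hz

theorem evalAt_hopfHom {z₁ z₂ : ℂ} {x : Sphere2} (h : IsHopf z₁ z₂ x) (p : MvPolynomial (Fin 3) ℂ) :
    evalAt z₁ z₂ (hopfHom p) = restrict p x := by
  obtain ⟨h1, h2⟩ := h
  have h1' := congrArg (starRingEnd ℂ) h1
  simp only [map_add, map_mul, Complex.conj_ofReal, Complex.conj_I, Complex.conj_conj,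
    map_ofNat] at h1'
  have h2' : ((x.1 2 : ℝ) : ℂ) = (starRingEnd ℂ) z₁ * z₁ - (starRingEnd ℂ) z₂ * z₂ := by
    rw [h2, Complex.conj_mul', Complex.conj_mul']
    push_cast
    rfl
  have key : (evalAt z₁ z₂).comp hopfHom =
      MvPolynomial.aeval (fun i => ((x.1 i : ℝ) : ℂ)) := by
    apply MvPolynomial.algHom_ext
    intro i
    -- The coordinates x and y are recovered from x + iy = 2 z̄₁z₂ together with its conjugate
    -- equation.
    fin_cases i
    · simp [evalAt, hopfHom]
      linear_combination -(1 / 2 : ℂ) * h1 - (1 / 2 : ℂ) * h1'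
    · simp [evalAt, hopfHom]
      linear_combination (Complex.I / 2) * h1 - (Complex.I / 2) * h1' -
        ((x.1 1 : ℝ) : ℂ) * Complex.I_mul_I
    · simp [evalAt, hopfHom]
      exact h2'.symm
  have := DFunLike.congr_fun key p
  rw [AlgHom.comp_apply] at this
  rw [this]
  simp [restrict, MvPolynomial.aeval_def, MvPolynomial.eval₂_eq', MvPolynomial.eval_eq']

/-- Away from the south pole a lift is z₁ = √((1+z)/2), z₂ = (x+iy)/(2z₁); above the pole, where
this z₁ vanishes, (0,1) is a lift. -/
theorem exists_isHopf (x : Sphere2) :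
    ∃ z₁ z₂ : ℂ, ‖z₁‖ ^ 2 + ‖z₂‖ ^ 2 = 1 ∧ IsHopf z₁ z₂ x := by
  have hx : x.1 0 ^ 2 + x.1 1 ^ 2 + x.1 2 ^ 2 = 1 := by
    have h := EuclideanSpace.real_norm_sq_eq x.1
    rw [mem_sphere_zero_iff_norm.1 x.2, Fin.sum_univ_three] at h
    linarith
  by_cases hz : x.1 2 = -1
  · have h0 : x.1 0 = 0 := by nlinarith
    have h1 : x.1 1 = 0 := by nlinarith
    exact ⟨0, 1, by simp, by simp [h0, h1], by simp [hz]⟩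
  · have hpos : 0 < 1 + x.1 2 := by
      have : -1 ≤ x.1 2 := by nlinarith
      rcases this.lt_or_eq with h | h
      · linarith
      · exact absurd h.symm hz
    set r := Real.sqrt ((1 + x.1 2) / 2) with hr
    have hrpos : 0 < r := Real.sqrt_pos.2 (by linarith)
    have hr2 : r ^ 2 = (1 + x.1 2) / 2 := Real.sq_sqrt (by linarith)
    have hn1 : ‖(r : ℂ)‖ ^ 2 = (1 + x.1 2) / 2 := by
      rw [Complex.norm_real, Real.norm_eq_abs, sq_abs, hr2]
    have hn2 : ‖(((x.1 0 : ℝ) : ℂ) + Complex.I * ((x.1 1 : ℝ) : ℂ)) / (2 * (r : ℂ))‖ ^ 2 =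
        (1 - x.1 2) / 2 := by
      rw [norm_div, div_pow, mul_comm Complex.I, Complex.sq_norm, Complex.normSq_add_mul_I, norm_mul,
        mul_pow, hn1, Complex.norm_ofNat]
      field_simp
      linarith
    refine ⟨r, (((x.1 0 : ℝ) : ℂ) + Complex.I * ((x.1 1 : ℝ) : ℂ)) / (2 * (r : ℂ)), ?_, ?_, ?_⟩
    · rw [hn1, hn2]
      ring
    · have : (r : ℂ) ≠ 0 := by exact_mod_cast hrpos.ne'
      rw [Complex.conj_ofReal]
      field_simp
    · rw [hn1, hn2]
      ring

theorem exists_sphere_isHopf {z₁ z₂ : ℂ} (hz : ‖z₁‖ ^ 2 + ‖z₂‖ ^ 2 = 1) :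
    ∃ x : Sphere2, IsHopf z₁ z₂ x := by
  set w : ℂ := 2 * (starRingEnd ℂ) z₁ * z₂ with hw
  have hw2 : w.re ^ 2 + w.im ^ 2 = 4 * ‖z₁‖ ^ 2 * ‖z₂‖ ^ 2 := by
    have h : ‖w‖ ^ 2 = 4 * ‖z₁‖ ^ 2 * ‖z₂‖ ^ 2 := by
      rw [hw, norm_mul, norm_mul, Complex.norm_conj, Complex.norm_ofNat]
      ring
    rw [← h, Complex.sq_norm, Complex.normSq_apply]
    ring
  refine ⟨⟨!₂[w.re, w.im, ‖z₁‖ ^ 2 - ‖z₂‖ ^ 2], ?_⟩, ?_, ?_⟩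
  · rw [mem_sphere_zero_iff_norm, ← sq_eq_sq₀ (norm_nonneg _) zero_le_one,
      EuclideanSpace.real_norm_sq_eq, Fin.sum_univ_three]
    simp only [Matrix.cons_val_zero, Matrix.cons_val_one, Matrix.cons_val]
    rw [hw2]
    linear_combination (‖z₁‖ ^ 2 + ‖z₂‖ ^ 2 + 1) * hz
  · simp only [Matrix.cons_val_zero, Matrix.cons_val_one]
    rw [mul_comm Complex.I, Complex.re_add_im]
  · simp

/-! ### Symbol maps -/

/-- The spherical harmonic with the given label. -/
noncomputable def harmVec (n : ℕ) (i : Label n) : Sphere2 → ℂ := restrict (harmonicAux i.1 i.2)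

theorem sphHarm_eq {l k : ℕ} (hk : k ≤ 2 * l) :
    sphHarm l ((l : ℤ) - k) = restrict (harmonicAux l k) := by
  rw [sphHarm, if_pos (by rw [abs_le]; omega)]
  congr
  omega

theorem sphHarm_eq_zero {l : ℕ} {m : ℤ} (h : ¬ |m| ≤ (l : ℤ)) : sphHarm l m = 0 :=
  if_neg h

theorem ofReal_sqrt_add_one_ne_zero (n : ℕ) : ((Real.sqrt ((n : ℝ) + 1) : ℝ) : ℂ) ≠ 0 := by
  exact_mod_cast (Real.sqrt_pos.2 (by positivity)).ne'

theorem hasCharNumbers_iff {n : ℕ} {c : ℕ → ℝ}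
    {W : Matrix (Fin (n + 1)) (Fin (n + 1)) ℂ →ₗ[ℂ] (Sphere2 → ℂ)} :
    HasCharNumbers n c W ↔ ∀ i : Label n,
      W (((Real.sqrt ((n : ℝ) + 1) : ℝ) : ℂ) • coupledVec n i) =
        ((c i.1 : ℝ) : ℂ) • harmVec n i := by
  constructor
  · rintro h ⟨l, k⟩
    have h1 := h l (by omega) ((l : ℕ) - (k : ℕ)) (by rw [abs_le]; omega)
    rwa [coupledC_eq_coupledVec (by omega) (by omega), sphHarm_eq (by omega)] at h1
  · intro h l hl m hm
    obtain ⟨k, hk, rfl⟩ := exists_eq_sub_of_abs_le hm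
    rw [coupledC_eq_coupledVec hl hk, sphHarm_eq hk]
    exact h ⟨⟨l, Nat.lt_succ_of_le hl⟩, ⟨k, Nat.lt_succ_of_le hk⟩⟩

theorem HasCharNumbers.unique {n : ℕ} {c : ℕ → ℝ}
    {W W' : Matrix (Fin (n + 1)) (Fin (n + 1)) ℂ →ₗ[ℂ] (Sphere2 → ℂ)}
    (h : HasCharNumbers n c W) (h' : HasCharNumbers n c W') : W = W' := by
  rw [hasCharNumbers_iff] at h h'
  refine (coupledBasis n).ext fun i => ?_
  have := (h i).trans (h' i).symm
  rw [map_smul, map_smul] at this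
  rw [coupledBasis_apply]
  exact smul_right_injective _ (ofReal_sqrt_add_one_ne_zero n) this

theorem exists_hasCharNumbers (n : ℕ) (c : ℕ → ℝ) :
    ∃ W : Matrix (Fin (n + 1)) (Fin (n + 1)) ℂ →ₗ[ℂ] (Sphere2 → ℂ), HasCharNumbers n c W := by
  refine ⟨(coupledBasis n).constr ℂ fun i =>
    (((Real.sqrt ((n : ℝ) + 1) : ℝ) : ℂ)⁻¹ * ((c i.1 : ℝ) : ℂ)) • harmVec n i, ?_⟩
  rw [hasCharNumbers_iff]
  intro i
  rw [map_smul, ← coupledBasis_apply, Module.Basis.constr_basis, smul_smul,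
    mul_inv_cancel_left₀ (ofReal_sqrt_add_one_ne_zero n)]

/-! ### The standard Berezin correspondence -/

theorem HasCharNumbers.apply_eq_evalAt {n : ℕ}
    {W : Matrix (Fin (n + 1)) (Fin (n + 1)) ℂ →ₗ[ℂ] (Sphere2 → ℂ)}
    (h : HasCharNumbers n (berezinNumber n) W) (P : Matrix (Fin (n + 1)) (Fin (n + 1)) ℂ)
    {x : Sphere2} {z₁ z₂ : ℂ} (hz : ‖z₁‖ ^ 2 + ‖z₂‖ ^ 2 = 1) (hx : IsHopf z₁ z₂ x) :
    W P x = evalAt z₁ z₂ (symbPoly n P) := by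
  rw [hasCharNumbers_iff] at h
  have key : (LinearMap.proj x).comp W = (evalAt z₁ z₂).toLinearMap.comp (symbPoly n) := by
    refine (coupledBasis n).ext fun i => ?_
    apply smul_right_injective _ (ofReal_sqrt_add_one_ne_zero n)
    simp only [← map_smul, coupledBasis_apply]
    rw [LinearMap.comp_apply, LinearMap.comp_apply, h, coupledVec,
      symbPoly_coupledAux (Nat.lt_succ_iff.1 i.1.2), AlgHom.toLinearMap_apply, map_mul, map_mul,
      map_pow, evalAt_normPoly hz, evalAt_hopfHom hx, one_pow, mul_one]
    simp [evalAt, harmVec]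
  exact LinearMap.congr_fun key P

/-- Surjectivity of the Hopf map makes the Berezin condition determine W completely, so W must equal
the map with characteristic numbers b_l, which satisfies that condition. -/
theorem isStandardBerezin_iff {n : ℕ}
    (W : Matrix (Fin (n + 1)) (Fin (n + 1)) ℂ →ₗ[ℂ] (Sphere2 → ℂ)) :
    IsStandardBerezin n W ↔ HasCharNumbers n (berezinNumber n) W := by
  constructor
  · intro h
    obtain ⟨W', hW'⟩ := exists_hasCharNumbers n (berezinNumber n)
    have : W = W' := by
      ext1 P
      funext x
      obtain ⟨z₁, z₂, hz, hx⟩ := exists_isHopf x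
      rw [h P x z₁ z₂ hz hx, hW'.apply_eq_evalAt P hz hx, evalAt_symbPoly]
    rwa [this]
  · intro h P x z₁ z₂ hz hx
    rw [h.apply_eq_evalAt P hz hx, evalAt_symbPoly]

/-! ### Injectivity of the Berezin correspondence. -/

theorem eq_zero_of_forall_sum_mul_pow_eq_zero {n : ℕ} (c : Fin n → ℂ)
    (h : ∀ s : ℂ, ∑ a, c a * s ^ (a : ℕ) = 0) (a : Fin n) : c a = 0 := by
  have hp : (∑ a, Polynomial.C (c a) * Polynomial.X ^ (a : ℕ) : Polynomial ℂ) = 0 := by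
    refine Polynomial.funext fun s => ?_
    simpa [Polynomial.eval_finsetSum] using h s
  have hc := congrArg (fun p => Polynomial.coeff p (a : ℕ)) hp
  simpa [Polynomial.finsetSum_coeff, Polynomial.coeff_X_pow, Fin.val_inj] using hc

/-- With t = x + iy this is a polynomial in x, y vanishing on ℝ², hence identically zero; over ℂ²
the values x - iy and x + iy are independent. -/
theorem eq_zero_of_forall_sum_conj_pow_mul_pow_eq_zero {n : ℕ} (c : Fin n → Fin n → ℂ)
    (h : ∀ t : ℂ, ∑ a, ∑ b, c a b * ((starRingEnd ℂ) t ^ (a : ℕ) * t ^ (b : ℕ)) = 0)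
    (a b : Fin n) : c a b = 0 := by
  let q : MvPolynomial (Fin 2) ℂ := ∑ a, ∑ b, MvPolynomial.C (c a b) *
    ((MvPolynomial.X 0 - MvPolynomial.C Complex.I * MvPolynomial.X 1) ^ (a : ℕ) *
      (MvPolynomial.X 0 + MvPolynomial.C Complex.I * MvPolynomial.X 1) ^ (b : ℕ))
  have hq : ∀ v : Fin 2 → ℂ, MvPolynomial.eval v q = ∑ a, ∑ b, c a b *
      ((v 0 - Complex.I * v 1) ^ (a : ℕ) * (v 0 + Complex.I * v 1) ^ (b : ℕ)) := by
    intro v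
    simp [q]
  have hq0 : q = 0 := by
    refine MvPolynomial.funext_set (fun _ => Set.range Complex.ofReal)
      (fun _ => Set.infinite_range_of_injective Complex.ofReal_injective) fun v hv => ?_
    obtain ⟨x, hx⟩ := hv 0 (Set.mem_univ _)
    obtain ⟨y, hy⟩ := hv 1 (Set.mem_univ _)
    rw [hq, map_zero, ← h (x + Complex.I * y), ← hx, ← hy]
    simp [sub_eq_add_neg]
  have hst : ∀ t s : ℂ, ∑ a, (∑ b, c a b * t ^ (b : ℕ)) * s ^ (a : ℕ) = 0 := by
    intro t s
    -- The complex point (x, y) is chosen so that x - iy = s and x + iy = t.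
    have h1 := hq ![(s + t) / 2, Complex.I * ((s - t) / 2)]
    rw [hq0, map_zero] at h1
    simp only [Matrix.cons_val_zero, Matrix.cons_val_one, ← mul_assoc, Complex.I_mul_I] at h1
    rw [show (s + t) / 2 - -1 * ((s - t) / 2) = s by ring,
      show (s + t) / 2 + -1 * ((s - t) / 2) = t by ring] at h1
    rw [h1]
    refine Finset.sum_congr rfl fun a _ => ?_
    rw [Finset.sum_mul]
    refine Finset.sum_congr rfl fun b _ => ?_
    ring
  exact eq_zero_of_forall_sum_mul_pow_eq_zero _ (fun t =>
    eq_zero_of_forall_sum_mul_pow_eq_zero _ (hst t) a) b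

theorem ofReal_sqrt_choose_ne_zero {n k : ℕ} (hk : k ≤ n) :
    ((Real.sqrt (n.choose k : ℝ) : ℝ) : ℂ) ≠ 0 := by
  have h : (0 : ℝ) < n.choose k := by exact_mod_cast Nat.choose_pos hk
  exact_mod_cast (Real.sqrt_pos.2 h).ne'

theorem HasCharNumbers.injective_of_berezin {n : ℕ}
    {W : Matrix (Fin (n + 1)) (Fin (n + 1)) ℂ →ₗ[ℂ] (Sphere2 → ℂ)}
    (h : HasCharNumbers n (berezinNumber n) W) : Function.Injective W := by
  rw [injective_iff_map_eq_zero]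
  intro P hP
  let c : Fin (n + 1) → Fin (n + 1) → ℂ := fun a b => P a b *
    (((Real.sqrt (n.choose (a : ℕ) : ℝ) : ℝ) : ℂ) * ((Real.sqrt (n.choose (b : ℕ) : ℝ) : ℝ) : ℂ))
  have hc : ∀ a b, c a b = 0 := by
    refine eq_zero_of_forall_sum_conj_pow_mul_pow_eq_zero c fun t => ?_
    -- Evaluating at the unit vector (1, t)/r and multiplying by r^(2n) makes the symbol a
    -- polynomial in t̄ and t, with coefficients P a b times nonzero square roots.
    set r := Real.sqrt (1 + ‖t‖ ^ 2) with hr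
    have hrpos : 0 < r := Real.sqrt_pos.2 (by positivity)
    have hr0 : (r : ℂ) ≠ 0 := by exact_mod_cast hrpos.ne'
    have hr2 : r ^ 2 = 1 + ‖t‖ ^ 2 := Real.sq_sqrt (by positivity)
    have hz : ‖(1 / r : ℂ)‖ ^ 2 + ‖(t / r : ℂ)‖ ^ 2 = 1 := by
      rw [norm_div, norm_div, Complex.norm_real, Real.norm_eq_abs, div_pow, div_pow, sq_abs, hr2,
        norm_one]
      field_simp
    obtain ⟨x, hx⟩ := exists_sphere_isHopf hz
    have h0 := h.apply_eq_evalAt P hz hx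
    rw [hP, Pi.zero_apply, symbPoly_apply] at h0
    have hterm : ∀ a b : Fin (n + 1),
        c a b * ((starRingEnd ℂ) t ^ (a : ℕ) * t ^ (b : ℕ)) = (r : ℂ) ^ (2 * n) *
          evalAt (1 / r) (t / r) (P a b • (phiPoly n 0 1 a * phiPoly n 2 3 b)) := by
      intro a b
      have e : ∀ k : ℕ, k ≤ n → (r : ℂ)⁻¹ ^ (n - k) * (r : ℂ)⁻¹ ^ k * (r : ℂ) ^ n = 1 := by
        intro k hk
        rw [← pow_add, Nat.sub_add_cancel hk, ← mul_pow, inv_mul_cancel₀ hr0, one_pow]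
      have ea := e a (by omega)
      have eb := e b (by omega)
      simp only [map_smul, map_mul, phiPoly, evalAt, map_pow, MvPolynomial.aeval_X,
        MvPolynomial.aeval_C, Matrix.cons_val_zero, Matrix.cons_val_one, Matrix.cons_val,
        Algebra.algebraMap_self, RingHom.id_apply, smul_eq_mul, map_inv₀,
        Complex.conj_ofReal, div_eq_mul_inv, one_mul, mul_pow, c]
      rw [two_mul, pow_add]
      generalize (r : ℂ)⁻¹ ^ (n - (a : ℕ)) = u at *
      generalize (r : ℂ)⁻¹ ^ (a : ℕ) = u' at *
      generalize (r : ℂ)⁻¹ ^ (n - (b : ℕ)) = v at *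
      generalize (r : ℂ)⁻¹ ^ (b : ℕ) = v' at *
      generalize (r : ℂ) ^ n = w at *
      linear_combination -(P a b * (((Real.sqrt (n.choose (a : ℕ) : ℝ) : ℝ) : ℂ) *
        ((Real.sqrt (n.choose (b : ℕ) : ℝ) : ℝ) : ℂ)) *
        ((starRingEnd ℂ) t ^ (a : ℕ) * t ^ (b : ℕ))) * (ea * (v * v' * w) + eb)
    simp only [hterm, ← Finset.mul_sum, ← map_sum]
    rw [← h0, mul_zero]
  ext a b
  have h1 := hc a b
  exact (mul_eq_zero.1 h1).resolve_right (mul_ne_zero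
    (ofReal_sqrt_choose_ne_zero (by omega)) (ofReal_sqrt_choose_ne_zero (by omega)))

/-! ### The range of the Berezin correspondence -/

/-- The span of the monomials of bidegree `(n, n)`. -/
noncomputable def bihomogeneous (n : ℕ) : Submodule ℂ (MvPolynomial (Fin 4) ℂ) :=
  Submodule.span ℂ {f | ∃ a b : ℕ, a ≤ n ∧ b ≤ n ∧
    f = MvPolynomial.X 0 ^ (n - a) * MvPolynomial.X 1 ^ a *
      (MvPolynomial.X 2 ^ (n - b) * MvPolynomial.X 3 ^ b)}

theorem mul_mem_bihomogeneous {n n' : ℕ} {f g : MvPolynomial (Fin 4) ℂ}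
    (hf : f ∈ bihomogeneous n) (hg : g ∈ bihomogeneous n') : f * g ∈ bihomogeneous (n + n') := by
  have h := Submodule.mul_mem_mul hf hg
  rw [bihomogeneous, bihomogeneous, Submodule.span_mul_span] at h
  refine Submodule.span_mono ?_ h
  rintro _ ⟨_, ⟨a, b, ha, hb, rfl⟩, _, ⟨a', b', ha', hb', rfl⟩, rfl⟩
  refine ⟨a + a', b + b', by omega, by omega, ?_⟩
  rw [show n + n' - (a + a') = (n - a) + (n' - a') by omega,
    show n + n' - (b + b') = (n - b) + (n' - b') by omega]
  simp only [pow_add]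
  ring

theorem C_mem_bihomogeneous (r : ℂ) : MvPolynomial.C r ∈ bihomogeneous 0 := by
  rw [← mul_one (MvPolynomial.C r), ← MvPolynomial.smul_eq_C_mul]
  exact Submodule.smul_mem _ _ (Submodule.subset_span ⟨0, 0, le_rfl, le_rfl, by simp⟩)

theorem pow_mem_bihomogeneous {f : MvPolynomial (Fin 4) ℂ} (hf : f ∈ bihomogeneous 1) (k : ℕ) :
    f ^ k ∈ bihomogeneous k := by
  induction k with
  | zero => simpa using C_mem_bihomogeneous 1
  | succ k ih =>
    rw [pow_succ]
    exact mul_mem_bihomogeneous ih hf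

theorem X_mul_X_mem_bihomogeneous {i j : Fin 4} (hi : i = 0 ∨ i = 1) (hj : j = 2 ∨ j = 3) :
    MvPolynomial.X i * MvPolynomial.X j ∈ bihomogeneous 1 := by
  apply Submodule.subset_span
  rcases hi with rfl | rfl <;> rcases hj with rfl | rfl
  · exact ⟨0, 0, by simp⟩
  · exact ⟨0, 1, by simp⟩
  · exact ⟨1, 0, by simp⟩
  · exact ⟨1, 1, by simp⟩

theorem normPoly_mem_bihomogeneous : normPoly ∈ bihomogeneous 1 :=
  add_mem (X_mul_X_mem_bihomogeneous (by simp) (by simp))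
    (X_mul_X_mem_bihomogeneous (by simp) (by simp))

theorem hopfHom_X_mem_bihomogeneous (i : Fin 3) :
    hopfHom (MvPolynomial.X i) ∈ bihomogeneous 1 := by
  have h03 := X_mul_X_mem_bihomogeneous (i := 0) (j := 3) (by simp) (by simp)
  have h12 := X_mul_X_mem_bihomogeneous (i := 1) (j := 2) (by simp) (by simp)
  have h02 := X_mul_X_mem_bihomogeneous (i := 0) (j := 2) (by simp) (by simp)
  have h13 := X_mul_X_mem_bihomogeneous (i := 1) (j := 3) (by simp) (by simp)
  rw [mul_comm] at h12
  rw [hopfHom, MvPolynomial.aeval_X]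
  fin_cases i
  · exact add_mem h03 h12
  · change MvPolynomial.C (-Complex.I) * _ ∈ _
    rw [← MvPolynomial.smul_eq_C_mul]
    exact Submodule.smul_mem _ _ (sub_mem h03 h12)
  · exact sub_mem h02 h13

theorem hopfHom_monomial_mem_bihomogeneous (s : Fin 3 →₀ ℕ) (r : ℂ) :
    hopfHom (MvPolynomial.monomial s r) ∈ bihomogeneous (s.sum fun _ e => e) := by
  have hs : (s.sum fun _ e => e) = 0 + (s 0 + s 1 + s 2) := by
    rw [Finsupp.sum_fintype _ _ (fun _ => rfl), Fin.sum_univ_three, zero_add]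
  rw [MvPolynomial.monomial_eq, Finsupp.prod_fintype _ _ (fun _ => pow_zero _), Fin.prod_univ_three,
    map_mul, hopfHom_C, map_mul, map_mul, map_pow, map_pow, map_pow, hs]
  have h := fun i => pow_mem_bihomogeneous (hopfHom_X_mem_bihomogeneous i) (s i)
  exact mul_mem_bihomogeneous (C_mem_bihomogeneous r)
    (mul_mem_bihomogeneous (mul_mem_bihomogeneous (h 0) (h 1)) (h 2))

theorem bihomogeneous_le_range (n : ℕ) : bihomogeneous n ≤ LinearMap.range (symbPoly n) := by
  refine Submodule.span_le.2 ?_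
  rintro _ ⟨a, b, ha, hb, rfl⟩
  let a' : Fin (n + 1) := ⟨a, Nat.lt_succ_of_le ha⟩
  let b' : Fin (n + 1) := ⟨b, Nat.lt_succ_of_le hb⟩
  let u : ℂ := ((Real.sqrt (n.choose a : ℝ) : ℝ) : ℂ)
  let v : ℂ := ((Real.sqrt (n.choose b : ℝ) : ℝ) : ℂ)
  have hu : u ≠ 0 := ofReal_sqrt_choose_ne_zero ha
  have hv : v ≠ 0 := ofReal_sqrt_choose_ne_zero hb
  refine ⟨Matrix.single a' b' ((u * v)⁻¹), ?_⟩
  rw [symbPoly_apply, Finset.sum_eq_single a', Finset.sum_eq_single b', Matrix.single_apply_same,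
    MvPolynomial.smul_eq_C_mul]
  · have h : (MvPolynomial.C ((u * v)⁻¹) * (MvPolynomial.C u * MvPolynomial.C v) :
        MvPolynomial (Fin 4) ℂ) = 1 := by
      rw [← map_mul, ← map_mul, inv_mul_cancel₀ (mul_ne_zero hu hv), map_one]
    change MvPolynomial.C ((u * v)⁻¹) * (MvPolynomial.C u * _ * (MvPolynomial.C v * _)) = _
    rw [mul_mul_mul_comm, ← mul_assoc, h, one_mul]
  · intro d _ hd
    rw [Matrix.single_apply_of_ne, zero_smul]
    exact fun h => hd h.2.symm
  · simp
  · intro d _ hd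
    refine Finset.sum_eq_zero fun e _ => ?_
    rw [Matrix.single_apply_of_ne, zero_smul]
    exact fun h => hd h.1.symm
  · simp

theorem isHomogeneous_X_mul_pderiv {p : MvPolynomial (Fin 3) ℂ} {l : ℕ} (hp : p.IsHomogeneous l)
    (i j : Fin 3) : (MvPolynomial.X i * MvPolynomial.pderiv j p).IsHomogeneous l := by
  -- Differentiation lowers the degree to l - 1, which truncates at l = 0; there p is constant and
  -- its derivative vanishes.
  cases l with
  | zero =>
    rw [← MvPolynomial.totalDegree_zero_iff_isHomogeneous,
      MvPolynomial.totalDegree_eq_zero_iff_eq_C] at hp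
    rw [hp, MvPolynomial.pderiv_C, mul_zero]
    exact MvPolynomial.isHomogeneous_zero _ _ _
  | succ l =>
    rw [add_comm]
    exact (MvPolynomial.isHomogeneous_X _ i).mul hp.pderiv

theorem isHomogeneous_harmonicAux (l k : ℕ) : (harmonicAux l k).IsHomogeneous l := by
  induction k with
  | zero =>
    have h := (((MvPolynomial.isHomogeneous_X ℂ (0 : Fin 3)).add
      ((MvPolynomial.isHomogeneous_X ℂ (1 : Fin 3)).C_mul Complex.I)).pow l).C_mul
        ((((-1) ^ l / lambdaNorm l : ℝ) : ℂ))
    rwa [one_mul] at h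
  | succ k ih =>
    have h := isHomogeneous_X_mul_pderiv ih
    exact ((((h 1 2).sub (h 2 1)).C_mul _).sub ((((h 2 0).sub (h 0 2)).C_mul _).C_mul _)).C_mul _ |>
      fun H => by simpa only [harmonicAux, JminusPoly, mul_sub, mul_assoc] using H

theorem harmVec_mem_polySphere (n : ℕ) (i : Label n) : harmVec n i ∈ polySphere n := by
  refine Submodule.mem_map_of_mem ?_
  rw [MvPolynomial.mem_restrictTotalDegree]
  exact (isHomogeneous_harmonicAux _ _).totalDegree_le.trans (Nat.lt_succ_iff.1 i.1.2)

theorem HasCharNumbers.range_le {n : ℕ} {c : ℕ → ℝ}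
    {W : Matrix (Fin (n + 1)) (Fin (n + 1)) ℂ →ₗ[ℂ] (Sphere2 → ℂ)} (h : HasCharNumbers n c W) :
    LinearMap.range W ≤ polySphere n := by
  rw [hasCharNumbers_iff] at h
  rintro _ ⟨P, rfl⟩
  rw [← (coupledBasis n).sum_repr P, map_sum]
  refine sum_mem fun i _ => ?_
  rw [map_smul]
  refine Submodule.smul_mem _ _ ?_
  rw [← Submodule.smul_mem_iff _ (ofReal_sqrt_add_one_ne_zero n), ← map_smul, coupledBasis_apply, h]
  exact Submodule.smul_mem _ _ (harmVec_mem_polySphere n i)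

/-- Multiplying by a power of N, which is 1 on unit vectors, raises each pulled-back monomial to
bidegree (n,n) without changing its values. -/
theorem HasCharNumbers.range_of_berezin {n : ℕ}
    {W : Matrix (Fin (n + 1)) (Fin (n + 1)) ℂ →ₗ[ℂ] (Sphere2 → ℂ)}
    (h : HasCharNumbers n (berezinNumber n) W) : LinearMap.range W = polySphere n := by
  refine le_antisymm h.range_le ?_
  rintro _ ⟨p, hp, rfl⟩
  have hp' : p.totalDegree ≤ n := (MvPolynomial.mem_restrictTotalDegree _ _ _).1 hp
  rw [p.as_sum, map_sum]
  refine sum_mem fun s hs => ?_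
  have hsn : (s.sum fun _ e => e) ≤ n := (MvPolynomial.le_totalDegree hs).trans hp'
  have hmem := mul_mem_bihomogeneous (hopfHom_monomial_mem_bihomogeneous s (p.coeff s))
    (pow_mem_bihomogeneous normPoly_mem_bihomogeneous (n - s.sum fun _ e => e))
  rw [Nat.add_sub_cancel' hsn] at hmem
  obtain ⟨P, hP⟩ := bihomogeneous_le_range n hmem
  refine ⟨P, ?_⟩
  funext x
  obtain ⟨z₁, z₂, hz, hx⟩ := exists_isHopf x
  rw [h.apply_eq_evalAt P hz hx, hP, map_mul, map_pow, evalAt_normPoly hz, one_pow, mul_one,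
    evalAt_hopfHom hx]

/-! ### Arbitrary characteristic numbers -/

/-- The operator on matrices scaling the coupled basis vectors `e(l,m)` by `d l`. -/
noncomputable def scaleCoupled (n : ℕ) (d : ℕ → ℝ) :
    Matrix (Fin (n + 1)) (Fin (n + 1)) ℂ →ₗ[ℂ] Matrix (Fin (n + 1)) (Fin (n + 1)) ℂ :=
  (coupledBasis n).constr ℂ fun i => ((d i.1 : ℝ) : ℂ) • coupledVec n i

theorem scaleCoupled_coupledVec (n : ℕ) (d : ℕ → ℝ) (i : Label n) :
    scaleCoupled n d (coupledVec n i) = ((d i.1 : ℝ) : ℂ) • coupledVec n i := by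
  rw [scaleCoupled, ← coupledBasis_apply, Module.Basis.constr_basis, coupledBasis_apply]

theorem scaleCoupled_scaleCoupled {n : ℕ} {d d' : ℕ → ℝ} (h : ∀ l ≤ n, d l * d' l = 1)
    (P : Matrix (Fin (n + 1)) (Fin (n + 1)) ℂ) : scaleCoupled n d (scaleCoupled n d' P) = P := by
  have key : (scaleCoupled n d).comp (scaleCoupled n d') = LinearMap.id := by
    refine (coupledBasis n).ext fun i => ?_
    rw [LinearMap.comp_apply, coupledBasis_apply, scaleCoupled_coupledVec, map_smul,
      scaleCoupled_coupledVec, smul_smul, ← Complex.ofReal_mul, mul_comm,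
      h _ (Nat.lt_succ_iff.1 i.1.2), Complex.ofReal_one, one_smul, LinearMap.id_apply]
  exact LinearMap.congr_fun key P

theorem bijective_scaleCoupled {n : ℕ} {d : ℕ → ℝ} (h : ∀ l ≤ n, d l ≠ 0) :
    Function.Bijective (scaleCoupled n d) :=
  Function.bijective_iff_has_inverse.2 ⟨scaleCoupled n fun l => (d l)⁻¹,
    scaleCoupled_scaleCoupled fun l hl => inv_mul_cancel₀ (h l hl),
    scaleCoupled_scaleCoupled fun l hl => mul_inv_cancel₀ (h l hl)⟩

theorem HasCharNumbers.eq_comp_scaleCoupled {n : ℕ} {c c' : ℕ → ℝ} (hc' : ∀ l ≤ n, c' l ≠ 0)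
    {W W' : Matrix (Fin (n + 1)) (Fin (n + 1)) ℂ →ₗ[ℂ] (Sphere2 → ℂ)}
    (h : HasCharNumbers n c W) (h' : HasCharNumbers n c' W') :
    W = W'.comp (scaleCoupled n fun l => c l / c' l) := by
  refine h.unique (hasCharNumbers_iff.2 fun i => ?_)
  rw [LinearMap.comp_apply, map_smul, scaleCoupled_coupledVec, smul_comm, map_smul,
    hasCharNumbers_iff.1 h', smul_smul, ← Complex.ofReal_mul,
    div_mul_cancel₀ _ (hc' _ (Nat.lt_succ_iff.1 i.1.2))]

theorem HasCharNumbers.injective {n : ℕ} {c : ℕ → ℝ} (hc : ∀ l ≤ n, c l ≠ 0)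
    {W : Matrix (Fin (n + 1)) (Fin (n + 1)) ℂ →ₗ[ℂ] (Sphere2 → ℂ)}
    (h : HasCharNumbers n c W) : Function.Injective W := by
  obtain ⟨W', hW'⟩ := exists_hasCharNumbers n (berezinNumber n)
  have hb : ∀ l ≤ n, berezinNumber n l ≠ 0 := fun l hl => (berezinNumber_pos hl).ne'
  rw [h.eq_comp_scaleCoupled hb hW', LinearMap.coe_comp]
  exact hW'.injective_of_berezin.comp
    (bijective_scaleCoupled fun l hl => div_ne_zero (hc l hl) (hb l hl)).injective

theorem HasCharNumbers.range_eq {n : ℕ} {c : ℕ → ℝ} (hc : ∀ l ≤ n, c l ≠ 0)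
    {W : Matrix (Fin (n + 1)) (Fin (n + 1)) ℂ →ₗ[ℂ] (Sphere2 → ℂ)}
    (h : HasCharNumbers n c W) : LinearMap.range W = polySphere n := by
  obtain ⟨W', hW'⟩ := exists_hasCharNumbers n (berezinNumber n)
  have hb : ∀ l ≤ n, berezinNumber n l ≠ 0 := fun l hl => (berezinNumber_pos hl).ne'
  rw [h.eq_comp_scaleCoupled hb hW', LinearMap.range_comp_of_range_eq_top, hW'.range_of_berezin]
  exact LinearMap.range_eq_top.2
    (bijective_scaleCoupled fun l hl => div_ne_zero (hc l hl) (hb l hl)).surjective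

/-! ### Twisted products of spherical harmonics. -/

theorem twistedProduct_apply {n : ℕ}
    {W : Matrix (Fin (n + 1)) (Fin (n + 1)) ℂ →ₗ[ℂ] (Sphere2 → ℂ)} (hW : Function.Injective W)
    (P Q : Matrix (Fin (n + 1)) (Fin (n + 1)) ℂ) : twistedProduct W (W P) (W Q) = W (P * Q) := by
  rw [twistedProduct, Function.leftInverse_invFun hW P, Function.leftInverse_invFun hW Q]

theorem HasCharNumbers.sphHarm_eq {n : ℕ} {c : ℕ → ℝ}
    {W : Matrix (Fin (n + 1)) (Fin (n + 1)) ℂ →ₗ[ℂ] (Sphere2 → ℂ)}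
    (h : HasCharNumbers n c W) {l : ℕ} (hl : l ≤ n) (hc : c l ≠ 0) {m : ℤ} (hm : |m| ≤ (l : ℤ)) :
    sphHarm l m =
      W ((((c l : ℝ) : ℂ)⁻¹ * ((Real.sqrt ((n : ℝ) + 1) : ℝ) : ℂ)) • coupledC n l m) := by
  rw [mul_smul, map_smul, h l hl m hm, inv_smul_smul₀ (Complex.ofReal_ne_zero.2 hc)]

theorem HasCharNumbers.twistedProduct_sphHarm {n : ℕ} {c : ℕ → ℝ} (hc : ∀ l ≤ n, c l ≠ 0)
    {W : Matrix (Fin (n + 1)) (Fin (n + 1)) ℂ →ₗ[ℂ] (Sphere2 → ℂ)} (h : HasCharNumbers n c W)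
    {l₁ l₂ : ℕ} {m₁ m₂ : ℤ} (hl₁ : l₁ ≤ n) (hl₂ : l₂ ≤ n) (hm₁ : |m₁| ≤ (l₁ : ℤ))
    (hm₂ : |m₂| ≤ (l₂ : ℤ)) :
    twistedProduct W (sphHarm l₁ m₁) (sphHarm l₂ m₂) =
      ((-1 : ℂ) ^ ((n : ℤ) + (m₁ + m₂)) * ((Real.sqrt ((n : ℝ) + 1) : ℝ) : ℂ)) •
        ∑ l ∈ Finset.range (n + 1),
          ((wignerProduct n l₁ l₂ l m₁ m₂ (-(m₁ + m₂)) * (c l / (c l₁ * c l₂)) : ℝ) : ℂ) •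
            sphHarm l (m₁ + m₂) := by
  rw [h.sphHarm_eq hl₁ (hc l₁ hl₁) hm₁, h.sphHarm_eq hl₂ (hc l₂ hl₂) hm₂,
    twistedProduct_apply (h.injective hc), smul_mul_smul_comm, coupledC_mul_coupledC,
    Finset.smul_sum, map_sum, Finset.smul_sum]
  refine Finset.sum_congr rfl fun l hl => ?_
  have hl' : l ≤ n := Nat.lt_succ_iff.1 (Finset.mem_range.1 hl)
  by_cases hm : |m₁ + m₂| ≤ (l : ℤ)
  · rw [h.sphHarm_eq hl' (hc l hl') hm, ← map_smul, ← map_smul]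
    simp only [smul_smul]
    congr 2
    rw [wignerProduct_eq]
    have h1 : ((c l : ℝ) : ℂ) ≠ 0 := Complex.ofReal_ne_zero.2 (hc l hl')
    have h2 : ((c l₁ : ℝ) : ℂ) ≠ 0 := Complex.ofReal_ne_zero.2 (hc l₁ hl₁)
    have h3 : ((c l₂ : ℝ) : ℂ) ≠ 0 := Complex.ofReal_ne_zero.2 (hc l₂ hl₂)
    -- The sign outside the sum cancels the identical sign built into the Wigner product symbol.
    have hs : ((-1 : ℂ) ^ ((n : ℤ) + (m₁ + m₂))) * (-1) ^ ((n : ℤ) + (m₁ + m₂)) = 1 := by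
      rw [← mul_zpow]
      norm_num
    push_cast
    field_simp
    linear_combination -((productCoeff n l₁ l₂ l m₁ m₂ (m₁ + m₂) : ℝ) : ℂ) * hs
  -- For l < |m₁ + m₂| both the matrix and the harmonic are zero by default, so the sum may run over
  -- all l ≤ n.
  · rw [coupledC, coupled_eq_zero n hm, Matrix.map_zero _ Complex.ofReal_zero, sphHarm_eq_zero hm,
      smul_zero, smul_zero, map_zero, smul_zero, smul_zero]

/-! ### The characteristic numbers of the standard Berezin correspondence -/

theorem berezinNumber_factor {n l₁ l₂ l₃ : ℕ} :
    berezinNumber n l₃ / (berezinNumber n l₁ * berezinNumber n l₂) =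
      Real.sqrt
        ((((n + l₁ + 1).choose l₁ : ℝ) * ((n + l₂ + 1).choose l₂ : ℝ) * (n.choose l₃ : ℝ)) /
          ((n.choose l₁ : ℝ) * (n.choose l₂ : ℝ) * ((n + l₃ + 1).choose l₃ : ℝ))) := by
  simp only [berezinNumber]
  rw [← Real.sqrt_div' _ (by positivity), ← Real.sqrt_div' _ (by positivity),
    ← Real.sqrt_div' _ (by positivity), ← Real.sqrt_mul (by positivity),
    ← Real.sqrt_div' _ (by positivity)]
  congr 1
  simp only [div_eq_mul_inv, mul_inv, inv_inv]
  ring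

theorem choose_div_choose {n l : ℕ} (hl : l ≤ n) :
    (n.choose l : ℝ) / ((n + l + 1).choose l : ℝ) =
      ((n.factorial : ℝ) * ((n + 1).factorial : ℝ)) /
        (((n + l + 1).factorial : ℝ) * ((n - l).factorial : ℝ)) := by
  have h2 := Nat.choose_pos (show l ≤ n + l + 1 by omega)
  have e1 := cast_choose_mul hl
  have e2 := cast_choose_mul (show l ≤ n + l + 1 by omega)
  rw [show n + l + 1 - l = n + 1 by omega] at e2
  rw [div_eq_div_iff (by positivity) (by positivity), ← e1, ← e2]
  ring

theorem choose_factor_eq {n l₁ l₂ l₃ : ℕ} (h₁ : l₁ ≤ n) (h₂ : l₂ ≤ n) (h₃ : l₃ ≤ n) :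
    (((n + l₁ + 1).choose l₁ : ℝ) * ((n + l₂ + 1).choose l₂ : ℝ) * (n.choose l₃ : ℝ)) /
        ((n.choose l₁ : ℝ) * (n.choose l₂ : ℝ) * ((n + l₃ + 1).choose l₃ : ℝ)) =
      (((n + l₁ + 1).factorial : ℝ) * ((n + l₂ + 1).factorial : ℝ) *
          ((n - l₁).factorial : ℝ) * ((n - l₂).factorial : ℝ)) /
        (((n + l₃ + 1).factorial : ℝ) * ((n - l₃).factorial : ℝ) *
          ((n + 1).factorial : ℝ) * (n.factorial : ℝ)) := by
  calc _ = ((n.choose l₁ : ℝ) / ((n + l₁ + 1).choose l₁ : ℝ))⁻¹ *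
        ((n.choose l₂ : ℝ) / ((n + l₂ + 1).choose l₂ : ℝ))⁻¹ *
        ((n.choose l₃ : ℝ) / ((n + l₃ + 1).choose l₃ : ℝ)) := by
        simp only [div_eq_mul_inv, mul_inv, inv_inv]
        ring
    _ = _ := by
        rw [choose_div_choose h₁, choose_div_choose h₂, choose_div_choose h₃]
        field_simp

end SpinSymbols

/-! ### The theorem and its corollary. -/

theorem theorem7p1p1 (n : ℕ) :
    -- symbol correspondences with arbitrary characteristic numbers
    (∀ c : ℕ → ℝ, c 0 = 1 → (∀ l : ℕ, 1 ≤ l → l ≤ n → c l ≠ 0) →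
      (∃! W : Matrix (Fin (n + 1)) (Fin (n + 1)) ℂ →ₗ[ℂ] (SpinSymbols.Sphere2 → ℂ),
        SpinSymbols.HasCharNumbers n c W) ∧
      ∀ W : Matrix (Fin (n + 1)) (Fin (n + 1)) ℂ →ₗ[ℂ] (SpinSymbols.Sphere2 → ℂ),
        SpinSymbols.HasCharNumbers n c W →
        Function.Injective W ∧
        LinearMap.range W = SpinSymbols.polySphere n ∧
        (∀ P Q : Matrix (Fin (n + 1)) (Fin (n + 1)) ℂ,
          SpinSymbols.twistedProduct W (W P) (W Q) = W (P * Q)) ∧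
        ∀ (l₁ l₂ : ℕ) (m₁ m₂ : ℤ), l₁ ≤ n → l₂ ≤ n → |m₁| ≤ (l₁ : ℤ) → |m₂| ≤ (l₂ : ℤ) →
          SpinSymbols.twistedProduct W (SpinSymbols.sphHarm l₁ m₁) (SpinSymbols.sphHarm l₂ m₂) =
            ((-1 : ℂ) ^ ((n : ℤ) + (m₁ + m₂)) * ((Real.sqrt ((n : ℝ) + 1) : ℝ) : ℂ)) •
              ∑ l ∈ Finset.range (n + 1),
                ((SpinSymbols.wignerProduct n l₁ l₂ l m₁ m₂ (-(m₁ + m₂)) *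
                    (c l / (c l₁ * c l₂)) : ℝ) : ℂ) • SpinSymbols.sphHarm l (m₁ + m₂)) ∧
    -- the standard Stratonovich-Weyl twisted product
    (∀ W : Matrix (Fin (n + 1)) (Fin (n + 1)) ℂ →ₗ[ℂ] (SpinSymbols.Sphere2 → ℂ),
      SpinSymbols.HasCharNumbers n (fun _ => 1) W →
      ∀ (l₁ l₂ : ℕ) (m₁ m₂ : ℤ), l₁ ≤ n → l₂ ≤ n → |m₁| ≤ (l₁ : ℤ) → |m₂| ≤ (l₂ : ℤ) →
        SpinSymbols.twistedProduct W (SpinSymbols.sphHarm l₁ m₁) (SpinSymbols.sphHarm l₂ m₂) =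
          ((-1 : ℂ) ^ ((n : ℤ) + (m₁ + m₂)) * ((Real.sqrt ((n : ℝ) + 1) : ℝ) : ℂ)) •
            ∑ l ∈ Finset.range (n + 1),
              ((SpinSymbols.wignerProduct n l₁ l₂ l m₁ m₂ (-(m₁ + m₂)) : ℝ) : ℂ) •
                SpinSymbols.sphHarm l (m₁ + m₂)) ∧
    -- the standard Berezin correspondence has the characteristic numbers `b_l^n`
    (∀ W : Matrix (Fin (n + 1)) (Fin (n + 1)) ℂ →ₗ[ℂ] (SpinSymbols.Sphere2 → ℂ),
      SpinSymbols.IsStandardBerezin n W ↔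
        SpinSymbols.HasCharNumbers n (SpinSymbols.berezinNumber n) W) ∧
    -- the factor of the standard Berezin twisted product
    (∀ l₁ l₂ l₃ : ℕ, l₁ ≤ n → l₂ ≤ n → l₃ ≤ n →
      SpinSymbols.berezinNumber n l₃ /
          (SpinSymbols.berezinNumber n l₁ * SpinSymbols.berezinNumber n l₂) =
        Real.sqrt
          ((((n + l₁ + 1).choose l₁ : ℝ) * ((n + l₂ + 1).choose l₂ : ℝ) * (n.choose l₃ : ℝ)) /
            ((n.choose l₁ : ℝ) * (n.choose l₂ : ℝ) * ((n + l₃ + 1).choose l₃ : ℝ))) ∧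
      SpinSymbols.berezinNumber n l₃ /
          (SpinSymbols.berezinNumber n l₁ * SpinSymbols.berezinNumber n l₂) =
        Real.sqrt
          ((((n + l₁ + 1).factorial : ℝ) * ((n + l₂ + 1).factorial : ℝ) *
              ((n - l₁).factorial : ℝ) * ((n - l₂).factorial : ℝ)) /
            (((n + l₃ + 1).factorial : ℝ) * ((n - l₃).factorial : ℝ) *
              ((n + 1).factorial : ℝ) * (n.factorial : ℝ)))) ∧
    -- the standard Berezin twisted product
    (∀ W : Matrix (Fin (n + 1)) (Fin (n + 1)) ℂ →ₗ[ℂ] (SpinSymbols.Sphere2 → ℂ),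
      SpinSymbols.IsStandardBerezin n W →
      ∀ (l₁ l₂ : ℕ) (m₁ m₂ : ℤ), l₁ ≤ n → l₂ ≤ n → |m₁| ≤ (l₁ : ℤ) → |m₂| ≤ (l₂ : ℤ) →
        SpinSymbols.twistedProduct W (SpinSymbols.sphHarm l₁ m₁) (SpinSymbols.sphHarm l₂ m₂) =
          ((-1 : ℂ) ^ ((n : ℤ) + (m₁ + m₂)) * ((Real.sqrt ((n : ℝ) + 1) : ℝ) : ℂ)) •
            ∑ l ∈ Finset.range (n + 1),
              ((SpinSymbols.wignerProduct n l₁ l₂ l m₁ m₂ (-(m₁ + m₂)) *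
                  Real.sqrt
                    ((((n + l₁ + 1).choose l₁ : ℝ) * ((n + l₂ + 1).choose l₂ : ℝ) *
                        (n.choose l : ℝ)) /
                      ((n.choose l₁ : ℝ) * (n.choose l₂ : ℝ) *
                        ((n + l + 1).choose l : ℝ))) : ℝ) : ℂ) •
                SpinSymbols.sphHarm l (m₁ + m₂)) := by
  have hb : ∀ l ≤ n, SpinSymbols.berezinNumber n l ≠ 0 := fun l hl =>
    (SpinSymbols.berezinNumber_pos hl).ne'
  refine ⟨fun c hc0 hc => ?_, fun W hW l₁ l₂ m₁ m₂ hl₁ hl₂ hm₁ hm₂ => ?_,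
    SpinSymbols.isStandardBerezin_iff, fun l₁ l₂ l₃ h₁ h₂ h₃ => ?_,
    fun W hW l₁ l₂ m₁ m₂ hl₁ hl₂ hm₁ hm₂ => ?_⟩
  · have hne : ∀ l ≤ n, c l ≠ 0 := by
      intro l hl
      rcases Nat.eq_zero_or_pos l with rfl | hpos
      · rw [hc0]
        exact one_ne_zero
      · exact hc l hpos hl
    refine ⟨?_, fun W hW => ⟨hW.injective hne, hW.range_eq hne,
      SpinSymbols.twistedProduct_apply (hW.injective hne), fun l₁ l₂ m₁ m₂ hl₁ hl₂ hm₁ hm₂ =>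
        hW.twistedProduct_sphHarm hne hl₁ hl₂ hm₁ hm₂⟩⟩
    obtain ⟨W, hW⟩ := SpinSymbols.exists_hasCharNumbers n c
    exact ⟨W, hW, fun W' hW' => hW'.unique hW⟩
  · simpa using hW.twistedProduct_sphHarm (fun _ _ => one_ne_zero) hl₁ hl₂ hm₁ hm₂
  · rw [SpinSymbols.berezinNumber_factor, SpinSymbols.choose_factor_eq h₁ h₂ h₃]
    exact ⟨rfl, rfl⟩
  · rw [((SpinSymbols.isStandardBerezin_iff W).1 hW).twistedProduct_sphHarm hb hl₁ hl₂ hm₁ hm₂]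
    simp only [SpinSymbols.berezinNumber_factor]
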